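/- Let $N=2$ and let $m>0$ be the electron mass. Let $\mathcal A$ be the set of two-electron wave functions $\Psi\in L^2((\mathbb R^3\times\mathbb Z_2)^2;\mathbb C)$ with (weak) gradient $\nabla\Psi\in L^2$, with $\|\Psi\|_{L^2}=1$, and antisymmetric: $\Psi(y,t,x,s)=-\Psi(x,s,y,t)$. For $\Psi\in\mathcal A$ let $$\rho_2^\Psi(x,y)=\sum_{s,t\in\mathbb Z_2}|\Psi(x,s,y,t)|^2,\qquad \rho^\Psi(x)=2\int_{\mathbb R^3}\rho_2^\Psi(x,y)\,dy$$ be its pair density and its single-particle density. Let $$\mathcal R=\Big\{\rho:\mathbb R^3\to\mathbb R\ \Big|\ \rho\ge 0,\ \sqrt\rho\in H^1(\mathbb R^3),\ \int_{\mathbb R^3}\rho(x)\,dx=2\Big\}.$$ For $\hbar>0$ and $\rho\in\mathcal R$ define the Hohenberg–Kohn functional $$F_{HK}^{\hbar}[\rho]=\inf_{\Psi\in\mathcal A,\ \rho^\Psi=\rho}\Big\{\frac{\hbar^2}{2m}\sum_{s,t\in\mathbb Z_2}\int_{\mathbb R^6}\big(|\nabla_x\Psi(x,s,y,t)|^2+|\nabla_y\Psi(x,s,y,t)|^2\big)\,dx\,dy+\int_{\mathbb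 R^6}\frac{\rho_2^\Psi(x,y)}{|x-y|}\,dx\,dy\Big\}$$ and the optimal transport functional with Coulomb cost $$E_{OT}[\rho]=\inf_{\gamma}\int_{\mathbb R^6}\frac{1}{|x-y|}\,d\gamma(x,y),$$ where the infimum is over all nonnegative Radon measures $\gamma$ on $\mathbb R^3\times\mathbb R^3$ both of whose marginals are $\tfrac12\rho(x)\,dx$ (and $1/|x-y|=+\infty$ for $x=y$). Then, for every $\rho\in\mathcal R$, $E_{OT}[\rho]$ is finite and $$\lim_{\hbar\to 0^+}F_{HK}^{\hbar}[\rho]=E_{OT}[\rho].$$ -/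

import Mathlib

open MeasureTheory Filter Topology
open scoped ENNReal ContDiff

noncomputable section

namespace SemiclassicalDFT

/-- Physical space `ℝ³` with the Euclidean norm. -/
abbrev Space : Type := EuclideanSpace ℝ (Fin 3)

/-- The two-point set of spin values. -/
abbrev Spin : Type := Fin 2

section Sobolev

variable {E F : Type*} [NormedAddCommGroup E] [NormedSpace ℝ E] [MeasureSpace E]
  [NormedAddCommGroup F] [NormedSpace ℝ F]

/-- `g` is the weak (distributional) derivative of `u` in the direction `v`:
`∫ (∂ᵥφ) u = - ∫ φ g` for every test function `φ ∈ C_c^∞`. -/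
def IsWeakDeriv (u : E → F) (v : E) (g : E → F) : Prop :=
  ∀ φ : E → ℝ, ContDiff ℝ ∞ φ → HasCompactSupport φ →
    ∫ x, (fderiv ℝ φ x v) • u x = - ∫ x, φ x • g x

/-- `u` belongs to the Sobolev space `H¹ = {u ∈ L² | ∇u ∈ L²}`. -/
def MemH1 (u : E → F) : Prop :=
  MemLp u 2 volume ∧ ∀ v : E, ∃ g : E → F, MemLp g 2 volume ∧ IsWeakDeriv u v g

open Classical in
/-- The weak derivative of `u` in the direction `v`, as a square-integrable function
(unique up to null sets); only used for `u ∈ H¹`, and `0` if there is none. -/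
def weakDeriv (u : E → F) (v : E) : E → F :=
  if h : ∃ g : E → F, MemLp g 2 volume ∧ IsWeakDeriv u v g then h.choose else 0

end Sobolev

/-- The spatial component of `Ψ(x,s,y,t)` at fixed spins `s`, `t`, a function on `ℝ³ × ℝ³`. -/
def spatial (Ψ : Space × Spin → Space × Spin → ℂ) (s t : Spin) : Space × Space → ℂ :=
  fun p => Ψ (p.1, s) (p.2, t)

/-- The pair density `ρ₂^Ψ(x,y) = ∑_{s,t} |Ψ(x,s,y,t)|²` of a two-electron wave function
(for `N = 2` it coincides with the `N`-point position density). -/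
def pairDensity (Ψ : Space × Spin → Space × Spin → ℂ) (p : Space × Space) : ℝ :=
  ∑ s : Spin, ∑ t : Spin, ‖spatial Ψ s t p‖ ^ 2

/-- The single-particle density `ρ^Ψ(x) = 2 ∫ ρ₂^Ψ(x,y) dy`. -/
def density (Ψ : Space × Spin → Space × Spin → ℂ) (x : Space) : ℝ :=
  2 * ∫ y : Space, pairDensity Ψ (x, y)

/-- The class `𝒜` of two-electron wave functions: `Ψ ∈ L²((ℝ³ × ℤ₂)²; ℂ)` with `∇Ψ ∈ L²`,
antisymmetric under exchange of the space-spin coordinates, of `L²` norm one. -/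
structure IsWaveFunction (Ψ : Space × Spin → Space × Spin → ℂ) : Prop where
  memH1 : ∀ s t : Spin, MemH1 (spatial Ψ s t)
  antisymm : ∀ s t : Spin, ∀ᵐ p : Space × Space, Ψ (p.2, t) (p.1, s) = - Ψ (p.1, s) (p.2, t)
  norm_eq_one : ∫ p : Space × Space, pairDensity Ψ p = 1

/-- `|∇_x u|² + |∇_y u|²` for a function `u(x,y)` on `ℝ³ × ℝ³`. -/
def gradSq (u : Space × Space → ℂ) (p : Space × Space) : ℝ≥0∞ :=
  ∑ k : Fin 3, (‖weakDeriv u (EuclideanSpace.single k 1, 0) p‖ₑ ^ 2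
    + ‖weakDeriv u (0, EuclideanSpace.single k 1) p‖ₑ ^ 2)

/-- The kinetic energy `T_ħ[Ψ] = ħ²/(2m) ∑_{s,t} ∫ (|∇_x Ψ|² + |∇_y Ψ|²) dx dy`. -/
def kineticEnergy (m hbar : ℝ) (Ψ : Space × Spin → Space × Spin → ℂ) : ℝ≥0∞ :=
  ENNReal.ofReal (hbar ^ 2 / (2 * m)) *
    ∑ s : Spin, ∑ t : Spin, ∫⁻ p : Space × Space, gradSq (spatial Ψ s t) p

/-- The Coulomb cost `1 / |x - y|`, equal to `+∞` on the diagonal. -/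
def coulomb (p : Space × Space) : ℝ≥0∞ := ‖p.1 - p.2‖ₑ⁻¹

/-- The electron-electron interaction energy `V_ee[Ψ] = ∫ ρ₂^Ψ(x,y) / |x - y| dx dy`. -/
def interactionEnergy (Ψ : Space × Spin → Space × Spin → ℂ) : ℝ≥0∞ :=
  ∫⁻ p : Space × Space, coulomb p * ENNReal.ofReal (pairDensity Ψ p)

/-- The Hohenberg–Kohn (Levy–Lieb constrained search) functional for two electrons:
`F_HK[ρ] = inf {T_ħ[Ψ] + V_ee[Ψ] | Ψ ∈ 𝒜, ρ^Ψ = ρ}`. -/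
def hohenbergKohn (m hbar : ℝ) (ρ : Space → ℝ) : ℝ≥0∞ :=
  ⨅ (Ψ : Space × Spin → Space × Spin → ℂ) (_ : IsWaveFunction Ψ)
    (_ : density Ψ =ᵐ[volume] ρ), kineticEnergy m hbar Ψ + interactionEnergy Ψ

/-- `γ ↦ ρ`: the nonnegative measure `γ` on `ℝ³ × ℝ³` satisfies
`2 ∫ γ(x,y) dy = ρ(x)` and `2 ∫ γ(x,y) dx = ρ(y)`, the relation between pair density
(of mass one) and single-particle density (of mass two) for two electrons. -/
def HasMarginals (γ : Measure (Space × Space)) (ρ : Space → ℝ) : Prop :=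
  (2 : ℝ≥0∞) • γ.map Prod.fst = volume.withDensity (fun x => ENNReal.ofReal (ρ x)) ∧
    (2 : ℝ≥0∞) • γ.map Prod.snd = volume.withDensity (fun x => ENNReal.ofReal (ρ x))

/-- The optimal transport functional with Coulomb cost,
`E_OT[ρ] = inf {∫ 1/|x-y| dγ(x,y) | γ ≥ 0, γ ↦ ρ}`. -/
def optimalTransport (ρ : Space → ℝ) : ℝ≥0∞ :=
  ⨅ (γ : Measure (Space × Space)) (_ : HasMarginals γ ρ), ∫⁻ p, coulomb p ∂γ

/-- The class `𝓡` of admissible two-electron densities: `ρ ≥ 0`, `√ρ ∈ H¹(ℝ³)`, `∫ ρ = 2`. -/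
structure IsAdmissible (ρ : Space → ℝ) : Prop where
  nonneg : ∀ᵐ x : Space, 0 ≤ ρ x
  sqrt_memH1 : MemH1 (fun x => Real.sqrt (ρ x))
  integral_eq : ∫ x : Space, ρ x = 2

end SemiclassicalDFT

end

/-! Lower bound: the pair density of an antisymmetric Ψ with density ρ is itself a coupling of μ =
ρ/2 dx with μ, and kinetic energy is nonnegative, so the transport cost bounds the functional from
below for every ħ (`optimalTransport_le_hohenbergKohn`). Upper bound: it suffices to find, for each
B above the transport cost, one Ψ of density exactly ρ with interaction energy below B. With Ψ
fixed, its gradient integral is finite and the kinetic term vanishes like ħ².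

The obstacle is that a nearly optimal plan may be singular, while convolving it would change its
marginals. The plan is therefore modified twice with both marginals kept exactly. In
`exists_separated_plan`, the small mass lying near the diagonal, or far out in both variables,
exchanges partners with mass on bounded sets at a safe distance; the added cost is proportional to
the mass exchanged. Now the cost is nearly constant on each charged product of small cells, and it
is negligible when one cell is the neighbourhood of infinity. So `exists_smooth_plan` redistributes
the mass of each product cell proportionally to μ ⊗ μ. Soft cells ηᵢ² with ∑ ηᵢ² = 1 make the
resulting density K = ∑ bₖ² with bₖ smooth, bounded and of bounded gradient.

The square root of such a sum is Lipschitz even where K vanishes, so √K √ρ(x) √ρ(y) is in H¹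
(`MemH1.sqrt_sum_sq_mul`). Antisymmetry imposes no constraint on this function: it fills the up-down
spin component, and minus its swap fills the down-up one (`exists_waveFunction`). Finiteness of the
transport cost comes from the exchange argument applied to μ ⊗ μ. -/

noncomputable section

namespace SemiclassicalDFT

/-! ### Weak derivatives and multiplication by √(∑ bₖ²) -/

section WeakDerivative

variable {E : Type*} [NormedAddCommGroup E] [NormedSpace ℝ E]

/-- The directional derivative of a test function is continuous. -/
lemma continuous_fderiv_apply_const {φ : E → ℝ} (hφ : ContDiff ℝ ∞ φ) (v : E) :
    Continuous fun x => fderiv ℝ φ x v :=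
  (hφ.continuous_fderiv (by simp)).clm_apply continuous_const

/-- The directional derivative of a compactly supported function is compactly supported. -/
lemma hasCompactSupport_fderiv_apply_const {φ : E → ℝ} (hc : HasCompactSupport φ) (v : E) :
    HasCompactSupport fun x => fderiv ℝ φ x v :=
  hc.fderiv_apply (𝕜 := ℝ) v

variable [MeasureSpace E]

/-- A real `H¹` function is `H¹` as a complex one. -/
lemma MemH1.ofReal {u : E → ℝ} (hu : MemH1 u) : MemH1 (fun x => (u x : ℂ)) := by
  refine ⟨hu.1.ofReal, fun v => ?_⟩
  obtain ⟨g, hg, hw⟩ := hu.2 v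
  refine ⟨fun x => (g x : ℂ), hg.ofReal, fun φ hφ hc => ?_⟩
  have := congrArg (fun t : ℝ => (t : ℂ)) (hw φ hφ hc)
  simp only [smul_eq_mul, Complex.ofReal_neg, ← integral_complex_ofReal, Complex.ofReal_mul] at this
  simpa only [Complex.real_smul] using this

lemma MemH1.const_mul {u : E → ℝ} (hu : MemH1 u) (c : ℝ) : MemH1 (fun x => c * u x) := by
  refine ⟨hu.1.const_mul c, fun v => ?_⟩
  obtain ⟨g, hg, hw⟩ := hu.2 v
  refine ⟨fun x => c * g x, hg.const_mul c, fun φ hφ hc => ?_⟩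
  have := hw φ hφ hc
  simp only [smul_eq_mul, mul_left_comm _ c, integral_const_mul] at this ⊢
  rw [this, mul_neg]

lemma memH1_zero : MemH1 (fun _ : E => (0 : ℂ)) :=
  ⟨MemLp.zero, fun _ => ⟨fun _ => 0, MemLp.zero, fun φ _ _ => by simp⟩⟩

variable [BorelSpace E] [IsLocallyFiniteMeasure (volume : Measure E)]

/-- A continuous compactly supported function times an `L²` function is integrable. -/
lemma integrable_mul_of_memLp_two {E : Type*} [NormedAddCommGroup E] [MeasureSpace E]
    [BorelSpace E] [IsLocallyFiniteMeasure (volume : Measure E)] {φ u : E → ℝ}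
    (hφ : Continuous φ) (hc : HasCompactSupport φ) (hu : MemLp u 2 volume) :
    Integrable fun x => φ x * u x :=
  (hu.locallyIntegrable one_le_two).integrable_smul_left_of_hasCompactSupport hφ hc

/-- Weak derivatives are additive in the direction. -/
lemma IsWeakDeriv.add_direction {u g₁ g₂ : E → ℝ} {v₁ v₂ : E} (hu : MemLp u 2 volume)
    (hg₁ : MemLp g₁ 2 volume) (hg₂ : MemLp g₂ 2 volume)
    (h₁ : IsWeakDeriv u v₁ g₁) (h₂ : IsWeakDeriv u v₂ g₂) :
    IsWeakDeriv u (v₁ + v₂) (fun x => g₁ x + g₂ x) := by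
  intro φ hφ hc
  have e₁ := h₁ φ hφ hc
  have e₂ := h₂ φ hφ hc
  simp only [smul_eq_mul, map_add, add_mul, mul_add] at *
  rw [integral_add, integral_add, e₁, e₂]
  · ring
  · exact integrable_mul_of_memLp_two hφ.continuous hc hg₁
  · exact integrable_mul_of_memLp_two hφ.continuous hc hg₂
  · exact integrable_mul_of_memLp_two (continuous_fderiv_apply_const hφ v₁)
      (hasCompactSupport_fderiv_apply_const hc v₁) hu
  · exact integrable_mul_of_memLp_two (continuous_fderiv_apply_const hφ v₂)
      (hasCompactSupport_fderiv_apply_const hc v₂) hu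

/-- Product rule for a smooth factor. -/
lemma IsWeakDeriv.smooth_mul {u g L : E → ℝ} {v : E} (hu : MemLp u 2 volume)
    (hg : MemLp g 2 volume) (h : IsWeakDeriv u v g) (hL : ContDiff ℝ ∞ L) :
    IsWeakDeriv (fun x => L x * u x) v (fun x => L x * g x + fderiv ℝ L x v * u x) := by
  intro φ hφ hc
  have hcL : HasCompactSupport (fun x => φ x * L x) := hc.mul_right
  -- The product φL is again a test function, so the smooth factor is moved onto the test side.
  have e := h (fun x => φ x * L x) (hφ.mul hL) hcL
  have hd : ∀ x, fderiv ℝ (fun x => φ x * L x) x v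
      = φ x * fderiv ℝ L x v + fderiv ℝ φ x v * L x := by
    intro x
    rw [fderiv_fun_mul (hφ.differentiable (by simp) x) (hL.differentiable (by simp) x)]
    simp [mul_comm]
  have hcd := hasCompactSupport_fderiv_apply_const hc v
  have i₁ : Integrable fun x => (φ x * fderiv ℝ L x v) * u x :=
    integrable_mul_of_memLp_two (hφ.continuous.mul (continuous_fderiv_apply_const hL v))
      hc.mul_right hu
  have i₂ : Integrable fun x => (fderiv ℝ φ x v * L x) * u x :=
    integrable_mul_of_memLp_two ((continuous_fderiv_apply_const hφ v).mul hL.continuous)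
      hcd.mul_right hu
  have i₃ : Integrable fun x => (φ x * L x) * g x :=
    integrable_mul_of_memLp_two (hφ.continuous.mul hL.continuous) hcL hg
  simp only [smul_eq_mul, hd, add_mul] at e ⊢
  rw [integral_add i₁ i₂] at e
  have e₁ : ∫ x, fderiv ℝ φ x v * (L x * u x) = ∫ x, (fderiv ℝ φ x v * L x) * u x := by
    simp only [mul_assoc]
  have e₂ : ∫ x, φ x * (L x * g x + fderiv ℝ L x v * u x)
      = (∫ x, (φ x * L x) * g x) + ∫ x, (φ x * fderiv ℝ L x v) * u x := by
    rw [← integral_add i₃ i₁]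
    congr 1; ext x; ring
  rw [e₁, e₂]
  linarith

/-- Weak derivatives are stable under dominated pointwise convergence. -/
lemma IsWeakDeriv.of_tendsto {u g U G : E → ℝ} {us gs : ℕ → E → ℝ} {v : E}
    (hU : MemLp U 2 volume) (hG : MemLp G 2 volume)
    (hus : ∀ n, AEStronglyMeasurable (us n) volume)
    (hgs : ∀ n, AEStronglyMeasurable (gs n) volume)
    (hbu : ∀ n x, |us n x| ≤ U x) (hbg : ∀ n x, |gs n x| ≤ G x)
    (hu : ∀ x, Tendsto (fun n => us n x) atTop (𝓝 (u x)))
    (hg : ∀ x, Tendsto (fun n => gs n x) atTop (𝓝 (g x)))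
    (h : ∀ n, IsWeakDeriv (us n) v (gs n)) : IsWeakDeriv u v g := by
  intro φ hφ hc
  have hcd := hasCompactSupport_fderiv_apply_const hc v
  have hφd := continuous_fderiv_apply_const hφ v
  simp only [smul_eq_mul]
  have key : ∀ {ψ w W : E → ℝ} {ws : ℕ → E → ℝ}, Continuous ψ → HasCompactSupport ψ →
      MemLp W 2 volume → (∀ n, AEStronglyMeasurable (ws n) volume) →
      (∀ n x, |ws n x| ≤ W x) → (∀ x, Tendsto (fun n => ws n x) atTop (𝓝 (w x))) →
      Tendsto (fun n => ∫ x, ψ x * ws n x) atTop (𝓝 (∫ x, ψ x * w x)) := by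
    intro ψ w W ws hψ hψc hW hws hb hw
    refine tendsto_integral_of_dominated_convergence (fun x => |ψ x| * W x) ?_ ?_ ?_ ?_
    · exact fun n => hψ.aestronglyMeasurable.mul (hws n)
    · exact integrable_mul_of_memLp_two hψ.abs (hψc.comp_left (g := fun t : ℝ => |t|) abs_zero) hW
    · intro n
      refine Eventually.of_forall fun x => ?_
      rw [Real.norm_eq_abs, abs_mul]
      exact mul_le_mul_of_nonneg_left (hb n x) (abs_nonneg _)
    · exact Eventually.of_forall fun x => (hw x).const_mul _
  refine tendsto_nhds_unique (key hφd hcd hU hus hbu hu) ?_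
  have := (key hφ.continuous hc hG hgs hbg hg).neg
  refine this.congr fun n => ?_
  simpa using (h n φ hφ hc).symm

variable {ι : Type*} [Fintype ι]

/-- Multiplying by `√(∑ bₖ²)`, with `bₖ` smooth, bounded and of bounded gradient, preserves `H¹`. -/
lemma MemH1.sqrt_sum_sq_mul {u : E → ℝ} (hu : MemH1 u) {b : ι → E → ℝ}
    (hb : ∀ k, ContDiff ℝ ∞ (b k)) (hbd : ∀ k, ∃ C, ∀ x, |b k x| ≤ C)
    (hbd' : ∀ k, ∃ C, ∀ x, ‖fderiv ℝ (b k) x‖ ≤ C) :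
    MemH1 (fun x => Real.sqrt (∑ k, b k x ^ 2) * u x) := by
  choose B hB using hbd
  choose D hD using hbd'
  set K : E → ℝ := fun x => ∑ k, b k x ^ 2 with hK
  have hK0 : ∀ x, 0 ≤ K x := fun x => Finset.sum_nonneg fun k _ => sq_nonneg _
  have hKs : ContDiff ℝ ∞ K := ContDiff.sum fun k _ => (hb k).pow 2
  set M : ℝ := ∑ k, B k ^ 2 with hM
  have hKM : ∀ x, K x ≤ M := fun x => Finset.sum_le_sum fun k _ =>
    sq_le_sq' (by linarith [neg_abs_le (b k x), hB k x]) ((le_abs_self _).trans (hB k x))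
  have hbound : ∀ x, ‖Real.sqrt (K x)‖ ≤ Real.sqrt M := fun x => by
    rw [Real.norm_eq_abs, abs_of_nonneg (Real.sqrt_nonneg _)]
    exact Real.sqrt_le_sqrt (hKM x)
  have hmul : ∀ (F f : E → ℝ) (C : ℝ), AEStronglyMeasurable F volume → (∀ x, ‖F x‖ ≤ C) →
      MemLp f 2 volume → MemLp (fun x => F x * f x) 2 volume := by
    intro F f C hF hFC hf
    refine hf.of_le_mul (c := C) (hF.mul hf.1) (Eventually.of_forall fun x => ?_)
    rw [norm_mul]
    exact mul_le_mul_of_nonneg_right (hFC x) (norm_nonneg _)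
  refine ⟨hmul _ _ _ hKs.continuous.sqrt.aestronglyMeasurable hbound hu.1, fun v => ?_⟩
  obtain ⟨g, hg, hw⟩ := hu.2 v
  have hdK : ∀ x, fderiv ℝ K x v = 2 * ∑ k, b k x * fderiv ℝ (b k) x v := by
    intro x
    have : HasFDerivAt K (∑ k, (2 * b k x) • fderiv ℝ (b k) x) x := by
      refine HasFDerivAt.fun_sum fun k _ => ?_
      have := ((hb k).differentiable (by simp) x).hasFDerivAt.pow 2
      simpa using this
    rw [this.fderiv]
    simp [Finset.mul_sum, mul_assoc]
  -- By Cauchy–Schwarz, |∂ᵥK| ≤ 2 √K S. This makes the derivative of √(K + e) bounded by S uniformly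
  -- in e > 0, including near zeros of K.
  set S : ℝ := Real.sqrt (∑ k, (D k * ‖v‖) ^ 2) with hS
  have hdK_le : ∀ x, |fderiv ℝ K x v| ≤ 2 * Real.sqrt (K x) * S := by
    intro x
    rw [hdK, abs_mul, abs_two, mul_assoc]
    refine mul_le_mul_of_nonneg_left ?_ zero_le_two
    rw [← Real.sqrt_sq_eq_abs, hS, ← Real.sqrt_mul (hK0 x)]
    refine Real.sqrt_le_sqrt ((Finset.sum_mul_sq_le_sq_mul_sq _ _ _).trans ?_)
    refine mul_le_mul_of_nonneg_left (Finset.sum_le_sum fun k _ => ?_) (hK0 x)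
    have h1 : |fderiv ℝ (b k) x v| ≤ D k * ‖v‖ :=
      ((fderiv ℝ (b k) x).le_opNorm v).trans
        (mul_le_mul_of_nonneg_right (hD k x) (norm_nonneg _))
    exact sq_le_sq' (by linarith [neg_abs_le (fderiv ℝ (b k) x v)]) ((le_abs_self _).trans h1)
  -- The square root need not be smooth where K vanishes. Adding e n > 0 makes the radicand
  -- positive, and the limit is taken in the weak formulation.
  set e : ℕ → ℝ := fun n => 1 / ((n : ℝ) + 1) with he
  have he0 : ∀ n, 0 < e n := fun n => by positivity
  have he1 : ∀ n, e n ≤ 1 := fun n => by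
    rw [he]; exact div_le_one_of_le₀ (by linarith [n.cast_nonneg (α := ℝ)]) (by positivity)
  have hlim : Tendsto e atTop (𝓝 0) := tendsto_one_div_add_atTop_nhds_zero_nat
  set L : ℕ → E → ℝ := fun n x => Real.sqrt (K x + e n) with hL
  have hLs : ∀ n, ContDiff ℝ ∞ (L n) := fun n =>
    (hKs.add contDiff_const).sqrt fun x => (add_pos_of_nonneg_of_pos (hK0 x) (he0 n)).ne'
  have hLp : ∀ n x, 0 < L n x := fun n x => Real.sqrt_pos.2 (by linarith [hK0 x, he0 n])
  have hLd : ∀ n x, fderiv ℝ (L n) x v = fderiv ℝ K x v / (2 * L n x) := by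
    intro n x
    have h1 : HasFDerivAt (fun x => K x + e n) (fderiv ℝ K x) x :=
      ((hKs.differentiable (by simp) x).hasFDerivAt).add_const _
    have h2 := h1.sqrt (add_pos_of_nonneg_of_pos (hK0 x) (he0 n)).ne'
    rw [h2.fderiv]
    simp [hL]
    ring
  have hLdb : ∀ n x, |fderiv ℝ (L n) x v| ≤ S := by
    intro n x
    rw [hLd, abs_div, abs_of_pos (mul_pos two_pos (hLp n x)),
      div_le_iff₀ (mul_pos two_pos (hLp n x))]
    have h1 : Real.sqrt (K x) ≤ L n x := Real.sqrt_le_sqrt (by linarith [he0 n])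
    have h2 : 0 ≤ S := Real.sqrt_nonneg _
    nlinarith [hdK_le x, mul_le_mul_of_nonneg_right h1 h2]
  have hLb : ∀ n x, |L n x| ≤ Real.sqrt (M + 1) := by
    intro n x
    rw [abs_of_pos (hLp n x)]
    exact Real.sqrt_le_sqrt (by linarith [hKM x, he1 n])
  have hLlim : ∀ x, Tendsto (fun n => L n x) atTop (𝓝 (Real.sqrt (K x))) := by
    intro x
    have : Tendsto (fun n => K x + e n) atTop (𝓝 (K x)) := by
      simpa using hlim.const_add (K x)
    exact (Real.continuous_sqrt.tendsto _).comp this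
  -- At zeros of K this is 0 / 0 = 0, which is the right limit: ∂ᵥK vanishes there by the bound
  -- above, hence so do all the regularized derivatives.
  set H : E → ℝ := fun x => fderiv ℝ K x v / (2 * Real.sqrt (K x)) with hH
  have hLdlim : ∀ x, Tendsto (fun n => fderiv ℝ (L n) x v) atTop (𝓝 (H x)) := by
    intro x
    simp only [hLd, hH]
    rcases (hK0 x).eq_or_lt with h0 | h0
    · have : fderiv ℝ K x v = 0 := by
        have := hdK_le x
        rw [← h0] at this
        simpa using this
      simp [this]
    · exact tendsto_const_nhds.div ((hLlim x).const_mul 2)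
        (mul_pos two_pos (Real.sqrt_pos.2 h0)).ne'
  have hHm : AEStronglyMeasurable H volume :=
    aestronglyMeasurable_of_tendsto_ae atTop
      (fun n => (continuous_fderiv_apply_const (hLs n) v).aestronglyMeasurable)
      (Eventually.of_forall hLdlim)
  have hHb : ∀ x, ‖H x‖ ≤ S := fun x =>
    le_of_tendsto (hLdlim x).norm (Eventually.of_forall fun n => hLdb n x)
  refine ⟨fun x => Real.sqrt (K x) * g x + H x * u x,
    (hmul _ _ _ hKs.continuous.sqrt.aestronglyMeasurable hbound hg).add
      (hmul _ _ _ hHm hHb hu.1), ?_⟩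
  refine IsWeakDeriv.of_tendsto (U := fun x => Real.sqrt (M + 1) * |u x|)
    (G := fun x => Real.sqrt (M + 1) * |g x| + S * |u x|)
    (us := fun n x => L n x * u x)
    (gs := fun n x => L n x * g x + fderiv ℝ (L n) x v * u x)
    (hu.1.abs.const_mul _) ((hg.abs.const_mul _).add (hu.1.abs.const_mul _))
    (fun n => (hLs n).continuous.aestronglyMeasurable.mul hu.1.1)
    (fun n => ((hLs n).continuous.aestronglyMeasurable.mul hg.1).add
      ((continuous_fderiv_apply_const (hLs n) v).aestronglyMeasurable.mul hu.1.1))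
    ?_ ?_ ?_ ?_ fun n => hw.smooth_mul hu.1 hg (hLs n)
  · intro n x
    rw [abs_mul]
    exact mul_le_mul_of_nonneg_right (hLb n x) (abs_nonneg _)
  · intro n x
    refine (abs_add_le _ _).trans (add_le_add ?_ ?_)
    · rw [abs_mul]
      exact mul_le_mul_of_nonneg_right (hLb n x) (abs_nonneg _)
    · rw [abs_mul]
      exact mul_le_mul_of_nonneg_right (hLdb n x) (abs_nonneg _)
  · exact fun x => (hLlim x).mul_const _
  · exact fun x => ((hLlim x).mul_const _).add ((hLdlim x).mul_const _)

end WeakDerivative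

/-! ### Tensor products in H¹ -/

/-- The product of two square-integrable functions of separate variables is square-integrable. -/
lemma memLp_two_tensor {a b : Space → ℝ} (ha : MemLp a 2 volume) (hb : MemLp b 2 volume) :
    MemLp (fun p : Space × Space => a p.1 * b p.2) 2 volume := by
  have hm : AEStronglyMeasurable (fun p : Space × Space => a p.1 * b p.2) volume :=
    ha.1.comp_fst.mul hb.1.comp_snd
  rw [memLp_two_iff_integrable_sq hm]
  simp only [mul_pow]
  exact ha.integrable_sq.mul_prod hb.integrable_sq

/-- Fubini reduces to fixed y. The slice φ(·, y) is a test function on `Space`, and b(y) is a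
constant factor. -/
lemma IsWeakDeriv.tensor_left {a g b : Space → ℝ} {v : Space} (ha : MemLp a 2 volume)
    (hg : MemLp g 2 volume) (hb : MemLp b 2 volume) (h : IsWeakDeriv a v g) :
    IsWeakDeriv (fun p : Space × Space => a p.1 * b p.2) (v, 0)
      (fun p => g p.1 * b p.2) := by
  intro φ hφ hc
  have i₁ := integrable_mul_of_memLp_two (continuous_fderiv_apply_const hφ ((v, 0) : Space × Space))
    (hasCompactSupport_fderiv_apply_const hc _) (memLp_two_tensor ha hb)
  have i₂ := integrable_mul_of_memLp_two hφ.continuous hc (memLp_two_tensor hg hb)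
  simp only [smul_eq_mul]
  rw [Measure.volume_eq_prod] at i₁ i₂ ⊢
  rw [integral_prod_symm _ i₁, integral_prod_symm _ i₂, ← integral_neg]
  congr 1
  ext y
  have hφy : ContDiff ℝ ∞ fun x : Space => φ (x, y) := hφ.comp (contDiff_prodMk_left y)
  have hcy : HasCompactSupport fun x : Space => φ (x, y) :=
    hc.comp_isClosedEmbedding (Topology.IsClosedEmbedding.of_continuous_injective_isClosedMap
      (Continuous.prodMk_left y) (fun _ _ h => congrArg Prod.fst h) (isClosedMap_prodMk_right y))
  have e := h _ hφy hcy
  have hd : ∀ x, fderiv ℝ (fun x : Space => φ (x, y)) x v = fderiv ℝ φ (x, y) (v, 0) := by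
    intro x
    have := ((hφ.differentiable (by simp) (x, y)).hasFDerivAt).comp x
      (hasFDerivAt_prodMk_left (𝕜 := ℝ) x y)
    rw [show (fun x : Space => φ (x, y)) = φ ∘ fun x => (x, y) from rfl, this.fderiv]
    simp
  simp only [smul_eq_mul, hd] at e
  simp only [← mul_assoc, integral_mul_const]
  rw [e, neg_mul]

lemma IsWeakDeriv.tensor_right {a g b : Space → ℝ} {v : Space} (ha : MemLp a 2 volume)
    (hg : MemLp g 2 volume) (hb : MemLp b 2 volume) (h : IsWeakDeriv a v g) :
    IsWeakDeriv (fun p : Space × Space => b p.1 * a p.2) (0, v)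
      (fun p => b p.1 * g p.2) := by
  intro φ hφ hc
  have i₁ := integrable_mul_of_memLp_two (continuous_fderiv_apply_const hφ ((0, v) : Space × Space))
    (hasCompactSupport_fderiv_apply_const hc _) (memLp_two_tensor hb ha)
  have i₂ := integrable_mul_of_memLp_two hφ.continuous hc (memLp_two_tensor hb hg)
  simp only [smul_eq_mul]
  rw [Measure.volume_eq_prod] at i₁ i₂ ⊢
  rw [integral_prod _ i₁, integral_prod _ i₂, ← integral_neg]
  congr 1
  ext x
  have hφx : ContDiff ℝ ∞ fun y : Space => φ (x, y) := hφ.comp (contDiff_prodMk_right x)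
  have hcx : HasCompactSupport fun y : Space => φ (x, y) :=
    hc.comp_isClosedEmbedding (Topology.IsClosedEmbedding.of_continuous_injective_isClosedMap
      (Continuous.prodMk_right x) (fun _ _ h => congrArg Prod.snd h) (isClosedMap_prodMk_left x))
  have e := h _ hφx hcx
  have hd : ∀ y, fderiv ℝ (fun y : Space => φ (x, y)) y v = fderiv ℝ φ (x, y) (0, v) := by
    intro y
    have := ((hφ.differentiable (by simp) (x, y)).hasFDerivAt).comp y
      (hasFDerivAt_prodMk_right (𝕜 := ℝ) x y)
    rw [show (fun y : Space => φ (x, y)) = φ ∘ fun y => (x, y) from rfl, this.fderiv]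
    simp
  simp only [smul_eq_mul, hd] at e
  simp only [mul_left_comm _ (b x), integral_const_mul]
  rw [e, mul_neg]

/-- Tensor products of `H¹` functions are `H¹`. -/
lemma MemH1.tensor {a b : Space → ℝ} (ha : MemH1 a) (hb : MemH1 b) :
    MemH1 (fun p : Space × Space => a p.1 * b p.2) := by
  refine ⟨memLp_two_tensor ha.1 hb.1, fun v => ?_⟩
  obtain ⟨g, hg, hga⟩ := ha.2 v.1
  obtain ⟨k, hk, hkb⟩ := hb.2 v.2
  refine ⟨fun p => g p.1 * b p.2 + a p.1 * k p.2,
    (memLp_two_tensor hg hb.1).add (memLp_two_tensor ha.1 hk), ?_⟩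
  have := (hga.tensor_left ha.1 hg hb.1).add_direction (memLp_two_tensor ha.1 hb.1)
    (memLp_two_tensor hg hb.1) (memLp_two_tensor ha.1 hk) (hkb.tensor_right hb.1 hk ha.1)
  simpa using this

/-! ### Exchange of partners between plans -/

section Exchange

variable {X : Type*} [MeasurableSpace X]

/-- Exchange of partners between two plans: pair first coordinates of `Γ` with second
coordinates of `G` and vice versa. -/
def exchange (Γ G : Measure (X × X)) : Measure (X × X) :=
  (G Set.univ)⁻¹ • ((Γ.map Prod.fst).prod (G.map Prod.snd)
    + (G.map Prod.fst).prod (Γ.map Prod.snd))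

variable {Γ G : Measure (X × X)}

/-- Every new pair takes one point from each of the two plans, so a distance between U and S becomes
a distance between the partners. -/
lemma ae_exchange {S U : Set X} (hS : MeasurableSet S) (hU : MeasurableSet U)
    (hΓ : ∀ᵐ p ∂Γ, p.1 ∈ U ∧ p.2 ∈ U) (hG : ∀ᵐ p ∂G, p.1 ∈ S ∧ p.2 ∈ S) :
    ∀ᵐ p ∂(exchange Γ G), (p.1 ∈ U ∧ p.2 ∈ S) ∨ (p.1 ∈ S ∧ p.2 ∈ U) := by
  have h₁ : ∀ᵐ x ∂(Γ.map Prod.fst), x ∈ U :=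
    (ae_map_iff measurable_fst.aemeasurable hU).2 (hΓ.mono fun _ h => h.1)
  have h₂ : ∀ᵐ x ∂(Γ.map Prod.snd), x ∈ U :=
    (ae_map_iff measurable_snd.aemeasurable hU).2 (hΓ.mono fun _ h => h.2)
  have h₃ : ∀ᵐ x ∂(G.map Prod.fst), x ∈ S :=
    (ae_map_iff measurable_fst.aemeasurable hS).2 (hG.mono fun _ h => h.1)
  have h₄ : ∀ᵐ x ∂(G.map Prod.snd), x ∈ S :=
    (ae_map_iff measurable_snd.aemeasurable hS).2 (hG.mono fun _ h => h.2)
  refine Measure.ae_smul_measure (ae_add_measure_iff.2 ⟨?_, ?_⟩) _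
  · filter_upwards [Measure.quasiMeasurePreserving_fst.ae h₁,
      Measure.quasiMeasurePreserving_snd.ae h₄] with p hp hq using Or.inl ⟨hp, hq⟩
  · filter_upwards [Measure.quasiMeasurePreserving_fst.ae h₃,
      Measure.quasiMeasurePreserving_snd.ae h₂] with p hp hq using Or.inr ⟨hp, hq⟩

variable [IsFiniteMeasure Γ] [IsFiniteMeasure G]

/-- Normalization by the mass of G leaves the marginal of Γ at full weight and that of G at weight
Γ(X)/G(X). Thus all of Γ and this fraction of G can be replaced by their exchange without altering
marginals. -/
lemma map_fst_exchange (hG : G Set.univ ≠ 0) :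
    (exchange Γ G).map Prod.fst = (Γ + (Γ Set.univ / G Set.univ) • G).map Prod.fst := by
  rw [exchange, Measure.map_smul, Measure.map_add _ _ measurable_fst,
    Measure.map_add _ _ measurable_fst, Measure.map_smul, Measure.map_fst_prod,
    Measure.map_fst_prod, Measure.map_apply measurable_snd .univ,
    Measure.map_apply measurable_snd .univ, Set.preimage_univ, smul_add, smul_smul, smul_smul,
    ENNReal.inv_mul_cancel hG (measure_ne_top _ _), one_smul, ENNReal.div_eq_inv_mul]

lemma map_snd_exchange (hG : G Set.univ ≠ 0) :
    (exchange Γ G).map Prod.snd = (Γ + (Γ Set.univ / G Set.univ) • G).map Prod.snd := by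
  rw [exchange, Measure.map_smul, Measure.map_add _ _ measurable_snd,
    Measure.map_add _ _ measurable_snd, Measure.map_smul, Measure.map_snd_prod,
    Measure.map_snd_prod, Measure.map_apply measurable_fst .univ,
    Measure.map_apply measurable_fst .univ, Set.preimage_univ, smul_add, smul_smul, smul_smul,
    ENNReal.inv_mul_cancel hG (measure_ne_top _ _), one_smul, ENNReal.div_eq_inv_mul, add_comm]

lemma exchange_univ (hG : G Set.univ ≠ 0) : exchange Γ G Set.univ = 2 * Γ Set.univ := by
  have h := congrArg (fun ν : Measure X => ν Set.univ) (map_fst_exchange (Γ := Γ) hG)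
  simp only [Measure.map_apply measurable_fst .univ, Set.preimage_univ, Measure.add_apply,
    Measure.smul_apply, smul_eq_mul, ENNReal.div_mul_cancel hG (measure_ne_top _ _)] at h
  rw [h, two_mul]

end Exchange

/-! ### Separating a plan from the diagonal and from infinity -/

lemma coulomb_le_of_le_dist {r : ℝ} {p : Space × Space} (h : r ≤ dist p.1 p.2) :
    coulomb p ≤ (ENNReal.ofReal r)⁻¹ := by
  rw [coulomb, ENNReal.inv_le_inv, ← ofReal_norm, ← dist_eq_norm]
  exact ENNReal.ofReal_le_ofReal h

lemma measurable_coulomb : Measurable coulomb := by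
  unfold coulomb
  fun_prop

/-- A plan with atomless marginals charges the squares of two bounded sets at positive distance
from each other. -/
lemma exists_separated_charged_sets {μ : Measure Space} [NullSingletonClass μ]
    {γ : Measure (Space × Space)}
    (h₁ : γ.map Prod.fst = μ) (h₂ : γ.map Prod.snd = μ) (hγ : γ ≠ 0) :
    ∃ (S₁ S₂ : Set Space) (r R : ℝ), 0 < r ∧ IsClosed S₁ ∧ IsClosed S₂ ∧
      (∀ x ∈ S₁, ‖x‖ ≤ R) ∧ (∀ x ∈ S₂, ‖x‖ ≤ R) ∧ (∀ x ∈ S₁, ∀ y ∈ S₂, 4 * r ≤ dist x y) ∧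
      γ (S₁ ×ˢ S₁) ≠ 0 ∧ γ (S₂ ×ˢ S₂) ≠ 0 := by
  obtain ⟨⟨x₁, y₁⟩, -, hp₁⟩ := exists_mem_forall_mem_nhdsWithin_pos_measure
    (show γ Set.univ ≠ 0 by simpa using hγ)
  have hpt : ∀ z : Space, γ {p | p.1 = z} = 0 ∧ γ {p | p.2 = z} = 0 := by
    intro z
    constructor
    · have := congrArg (fun ν : Measure Space => ν {z}) h₁
      simp only [Measure.map_apply measurable_fst (measurableSet_singleton z),
        measure_singleton] at this
      exact this
    · have := congrArg (fun ν : Measure Space => ν {z}) h₂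
      simp only [Measure.map_apply measurable_snd (measurableSet_singleton z),
        measure_singleton] at this
      exact this
  -- Pairs sharing a coordinate value with (x₁, y₁) form a null set, since the marginals have no
  -- atoms. A second support point (x₂, y₂) can therefore be chosen off it.
  set T : Set (Space × Space) := ({p | p.1 = x₁} ∪ {p | p.2 = x₁}) ∪
    ({p | p.1 = y₁} ∪ {p | p.2 = y₁}) with hT
  have hT0 : γ T = 0 :=
    measure_union_null (measure_union_null (hpt x₁).1 (hpt x₁).2)
      (measure_union_null (hpt y₁).1 (hpt y₁).2)
  have hTc : γ Tᶜ ≠ 0 := by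
    intro h
    apply hγ
    rw [← Measure.measure_univ_eq_zero, ← Set.union_compl_self T]
    exact measure_union_null hT0 h
  obtain ⟨⟨x₂, y₂⟩, hmem, hp₂⟩ := exists_mem_forall_mem_nhdsWithin_pos_measure hTc
  simp only [hT, Set.mem_compl_iff, Set.mem_union, Set.mem_ofPred_eq, not_or] at hmem
  obtain ⟨⟨hxx, hyx⟩, hxy, hyy⟩ := hmem
  set D : ℝ := min (min (dist x₂ x₁) (dist y₂ x₁)) (min (dist x₂ y₁) (dist y₂ y₁)) with hD
  have hD0 : 0 < D := by
    simp only [hD, lt_min_iff, dist_pos]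
    exact ⟨⟨hxx, hyx⟩, hxy, hyy⟩
  have hDa : D ≤ dist x₂ x₁ := (min_le_left _ _).trans (min_le_left _ _)
  have hDb : D ≤ dist y₂ x₁ := (min_le_left _ _).trans (min_le_right _ _)
  have hDc : D ≤ dist x₂ y₁ := (min_le_right _ _).trans (min_le_left _ _)
  have hDd : D ≤ dist y₂ y₁ := (min_le_right _ _).trans (min_le_right _ _)
  -- Balls of radius D/6 around centres at distance at least D stay 4 · D/6 apart. Each Sᵢ is the
  -- union of the balls around xᵢ and yᵢ, so that Sᵢ × Sᵢ is a neighbourhood of (xᵢ, yᵢ).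
  have hr : 0 < D / 6 := by positivity
  have hcb : ∀ x y : Space, (Metric.closedBall x (D / 6) ∪ Metric.closedBall y (D / 6)) ×ˢ
      (Metric.closedBall x (D / 6) ∪ Metric.closedBall y (D / 6)) ∈ 𝓝 (x, y) := fun x y =>
    prod_mem_nhds (mem_of_superset (Metric.closedBall_mem_nhds x hr) Set.subset_union_left)
      (mem_of_superset (Metric.closedBall_mem_nhds y hr) Set.subset_union_right)
  have hnorm : ∀ x z : Space, z ∈ Metric.closedBall x (D / 6) → ‖z‖ ≤ ‖x‖ + D / 6 := by
    intro x z hz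
    rw [Metric.mem_closedBall, dist_eq_norm] at hz
    have := norm_add_le x (z - x)
    rw [add_sub_cancel] at this
    linarith
  refine ⟨Metric.closedBall x₁ (D / 6) ∪ Metric.closedBall y₁ (D / 6),
    Metric.closedBall x₂ (D / 6) ∪ Metric.closedBall y₂ (D / 6), D / 6,
    ‖x₁‖ + ‖y₁‖ + ‖x₂‖ + ‖y₂‖ + D / 6, hr,
    Metric.isClosed_closedBall.union Metric.isClosed_closedBall,
    Metric.isClosed_closedBall.union Metric.isClosed_closedBall, ?_, ?_, ?_, ?_, ?_⟩
  · rintro z (hz | hz) <;> have := hnorm _ _ hz <;>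
      linarith [norm_nonneg x₁, norm_nonneg y₁, norm_nonneg x₂, norm_nonneg y₂]
  · rintro z (hz | hz) <;> have := hnorm _ _ hz <;>
      linarith [norm_nonneg x₁, norm_nonneg y₁, norm_nonneg x₂, norm_nonneg y₂]
  · have key : ∀ a b x y : Space, D ≤ dist b a → x ∈ Metric.closedBall a (D / 6) →
        y ∈ Metric.closedBall b (D / 6) → 4 * (D / 6) ≤ dist x y := by
      intro a b x y hab hx hy
      rw [Metric.mem_closedBall] at hx hy
      have := dist_triangle4 b y x a
      rw [dist_comm b y, dist_comm y x] at this
      linarith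
    rintro x (hx | hx) y (hy | hy)
    · exact key _ _ _ _ hDa hx hy
    · exact key _ _ _ _ hDb hx hy
    · exact key _ _ _ _ hDc hx hy
    · exact key _ _ _ _ hDd hx hy
  · exact pos_iff_ne_zero.1 (hp₁ _ (mem_nhdsWithin_of_mem_nhds (hcb _ _)))
  · exact pos_iff_ne_zero.1 (hp₂ _ (mem_nhdsWithin_of_mem_nhds (hcb _ _)))

/-- The pairs of points closer than `1 / (n + 1)` or both outside the ball of radius `n`. -/
def badPairs (n : ℕ) : Set (Space × Space) :=
  {p | dist p.1 p.2 < 1 / ((n : ℝ) + 1)} ∪ {p | (n : ℝ) < ‖p.1‖ ∧ (n : ℝ) < ‖p.2‖}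

lemma measurableSet_badPairs (n : ℕ) : MeasurableSet (badPairs n) := by
  refine (measurableSet_lt (by fun_prop) measurable_const).union ?_
  exact (measurableSet_lt measurable_const measurable_fst.norm).inter
    (measurableSet_lt measurable_const measurable_snd.norm)

/-- Continuity from above: a fixed pair is eventually inside the ball, so a pair that is bad for
every n must lie on the diagonal. -/
lemma tendsto_measure_badPairs {γ : Measure (Space × Space)} [IsFiniteMeasure γ]
    (hd : γ (Set.diagonal Space) = 0) : Tendsto (fun n => γ (badPairs n)) atTop (𝓝 0) := by
  have hanti : Antitone badPairs := by
    intro a b hab p hp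
    have hab' : (a : ℝ) ≤ b := by exact_mod_cast hab
    rcases hp with hp | hp
    · left
      have hp' : dist p.1 p.2 < 1 / ((b : ℝ) + 1) := hp
      exact lt_of_lt_of_le hp' (one_div_le_one_div_of_le (by positivity) (by linarith))
    · right
      exact ⟨lt_of_le_of_lt hab' hp.1, lt_of_le_of_lt hab' hp.2⟩
  have h := tendsto_measure_iInter_atTop (μ := γ)
    (fun n => (measurableSet_badPairs n).nullMeasurableSet) hanti ⟨0, measure_ne_top _ _⟩
  have hsub : ⋂ n, badPairs n ⊆ Set.diagonal Space := by
    intro p hp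
    by_contra hne
    have hpos : 0 < dist p.1 p.2 := dist_pos.2 hne
    obtain ⟨n, hn⟩ := exists_nat_one_div_lt hpos
    obtain ⟨k, hk⟩ := exists_nat_ge ‖p.1‖
    rcases Set.mem_iInter.1 hp (max n k) with h1 | h1
    · have h2 : (n : ℝ) ≤ (max n k : ℕ) := by exact_mod_cast le_max_left n k
      have h3 : 1 / (((max n k : ℕ) : ℝ) + 1) ≤ 1 / ((n : ℝ) + 1) :=
        one_div_le_one_div_of_le (by positivity) (by linarith)
      have h4 : dist p.1 p.2 < 1 / (((max n k : ℕ) : ℝ) + 1) := h1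
      linarith
    · have h2 : (k : ℝ) ≤ (max n k : ℕ) := by exact_mod_cast le_max_right n k
      have h3 : ((max n k : ℕ) : ℝ) < ‖p.1‖ := h1.1
      linarith
  rwa [measure_mono_null hsub hd] at h

/-- A plan that does not charge the diagonal can be modified, at arbitrarily small cost, so as to
stay at positive distance from the diagonal and to keep one of the particles in a bounded set. -/
lemma exists_separated_plan {μ : Measure Space} [IsProbabilityMeasure μ] [NullSingletonClass μ]
    {γ : Measure (Space × Space)} (h₁ : γ.map Prod.fst = μ) (h₂ : γ.map Prod.snd = μ)
    (hd : γ (Set.diagonal Space) = 0) {ε : ℝ≥0∞} (hε : ε ≠ 0) :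
    ∃ γ' : Measure (Space × Space), γ'.map Prod.fst = μ ∧ γ'.map Prod.snd = μ ∧
      (∃ δ : ℝ, 0 < δ ∧ ∃ R : ℝ, ∀ᵐ p ∂γ', δ ≤ dist p.1 p.2 ∧ (‖p.1‖ ≤ R ∨ ‖p.2‖ ≤ R)) ∧
      ∫⁻ p, coulomb p ∂γ' ≤ ∫⁻ p, coulomb p ∂γ + ε := by
  have hγu : γ Set.univ = 1 := by
    have := congrArg (fun ν : Measure Space => ν Set.univ) h₁
    simpa [Measure.map_apply measurable_fst .univ] using this
  have : IsProbabilityMeasure γ := ⟨hγu⟩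
  obtain ⟨S₁, S₂, r, R, hr, hS₁, hS₂, hR₁, hR₂, hsep, hm₁, hm₂⟩ :=
    exists_separated_charged_sets h₁ h₂ (IsProbabilityMeasure.ne_zero γ)
  have hr' : ENNReal.ofReal r ≠ 0 := by simpa using hr
  -- choice of the bad set
  have hlim := tendsto_measure_badPairs hd
  -- The first two conditions leave on each Sᵢ × Sᵢ, outside the bad set, at least as much mass as
  -- the bad set carries. The third bounds the cost of the exchanged pairs: mass 2γ(Bd), each at
  -- distance at least r.
  have e₁ := (tendsto_order.1 hlim).2 _ (ENNReal.half_pos hm₁)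
  have e₂ := (tendsto_order.1 hlim).2 _ (ENNReal.half_pos hm₂)
  have e₃ := (tendsto_order.1 hlim).2 _ (ENNReal.half_pos (mul_ne_zero hε hr'))
  have e₄ : ∀ᶠ n : ℕ in atTop, 1 / ((n : ℝ) + 1) < r :=
    (tendsto_order.1 tendsto_one_div_add_atTop_nhds_zero_nat).2 _ hr
  have e₅ : ∀ᶠ n : ℕ in atTop, R + 2 * r ≤ n :=
    tendsto_natCast_atTop_atTop.eventually_ge_atTop _
  obtain ⟨n, hn₁, hn₂, hn₃, hn₄, hn₅⟩ := (e₁.and (e₂.and (e₃.and (e₄.and e₅)))).exists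
  set Bd := badPairs n with hBd
  have hBdm : MeasurableSet Bd := measurableSet_badPairs n
  -- Two reservoirs are needed because a bad pair may lie near one of them. If its first point is
  -- within 2r of S₁, it is at least 2r from S₂, as these sets are 4r apart. The second point then
  -- stays r away too, being either within r of the first or far outside the ball of radius R.
  set T : Set Space := ⋂ s ∈ S₁, {x | 2 * r ≤ dist x s} with hT
  have hTm : MeasurableSet T := by
    refine IsClosed.measurableSet (isClosed_biInter fun s _ => ?_)
    exact isClosed_le continuous_const (by fun_prop)
  set U : Set Space → Set Space := fun S => ⋂ s ∈ S, {x | r ≤ dist x s} with hU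
  have hUm : ∀ S, MeasurableSet (U S) := by
    intro S
    refine IsClosed.measurableSet (isClosed_biInter fun s _ => ?_)
    exact isClosed_le continuous_const (by fun_prop)
  have hfar : ∀ x s : Space, (n : ℝ) < ‖x‖ → ‖s‖ ≤ R → 2 * r ≤ dist x s := by
    intro x s hx hs
    have := norm_sub_norm_le x s
    rw [dist_eq_norm]
    linarith
  have hb₁ : ∀ p ∈ Bd ∩ Prod.fst ⁻¹' T, p.1 ∈ U S₁ ∧ p.2 ∈ U S₁ := by
    rintro p ⟨hp, hpT⟩
    simp only [hT, hU, Set.mem_preimage, Set.mem_iInter, Set.mem_ofPred_eq] at hpT ⊢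
    refine ⟨fun s hs => by linarith [hpT s hs], fun s hs => ?_⟩
    rcases hp with hp | hp
    · have h3 : dist p.1 p.2 < 1 / ((n : ℝ) + 1) := hp
      linarith [hpT s hs, dist_triangle p.1 p.2 s]
    · linarith [hfar _ _ hp.2 (hR₁ s hs)]
  have hb₂ : ∀ p ∈ Bd \ Prod.fst ⁻¹' T, p.1 ∈ U S₂ ∧ p.2 ∈ U S₂ := by
    rintro p ⟨hp, hpT⟩
    simp only [hT, hU, Set.mem_preimage, Set.mem_iInter, Set.mem_ofPred_eq, not_forall,
      not_le] at hpT ⊢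
    obtain ⟨s₁, hs₁, hlt⟩ := hpT
    have hx : ∀ s ∈ S₂, 2 * r ≤ dist p.1 s := fun s hs => by
      have := dist_triangle s₁ p.1 s
      rw [dist_comm s₁ p.1] at this
      linarith [hsep s₁ hs₁ s hs]
    refine ⟨fun s hs => by linarith [hx s hs], fun s hs => ?_⟩
    rcases hp with hp | hp
    · have h3 : dist p.1 p.2 < 1 / ((n : ℝ) + 1) := hp
      linarith [hx s hs, dist_triangle p.1 p.2 s]
    · linarith [hfar _ _ hp.2 (hR₂ s hs)]
  -- decomposition of the plan
  set Q₁ := S₁ ×ˢ S₁ with hQ₁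
  set Q₂ := S₂ ×ˢ S₂ with hQ₂
  have hQ₁m : MeasurableSet Q₁ := hS₁.measurableSet.prod hS₁.measurableSet
  have hQ₂m : MeasurableSet Q₂ := hS₂.measurableSet.prod hS₂.measurableSet
  have hdisj : Disjoint Q₁ Q₂ := by
    rw [Set.disjoint_left]
    rintro p hp hq
    have := hsep _ hp.1 _ hq.1
    rw [dist_self] at this
    linarith
  set Γ₁ := γ.restrict (Bd ∩ Prod.fst ⁻¹' T) with hΓ₁
  set Γ₂ := γ.restrict (Bd \ Prod.fst ⁻¹' T) with hΓ₂
  set G₁ := γ.restrict (Bdᶜ ∩ Q₁) with hG₁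
  set G₂ := γ.restrict ((Bdᶜ \ Q₁) ∩ Q₂) with hG₂
  set P := γ.restrict ((Bdᶜ \ Q₁) \ Q₂) with hP
  have hdec : γ = P + G₁ + G₂ + Γ₁ + Γ₂ := by
    conv_lhs => rw [← Measure.restrict_add_restrict_compl (μ := γ) hBdm,
      ← Measure.restrict_inter_add_sdiff (μ := γ) Bd (hTm.preimage measurable_fst),
      ← Measure.restrict_inter_add_sdiff (μ := γ) Bdᶜ hQ₁m,
      ← Measure.restrict_inter_add_sdiff (μ := γ) (Bdᶜ \ Q₁) hQ₂m]
    abel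
  have hΓle : Γ₁ Set.univ + Γ₂ Set.univ = γ Bd := by
    simp only [hΓ₁, hΓ₂, Measure.restrict_apply_univ]
    exact measure_inter_add_sdiff _ (hTm.preimage measurable_fst)
  have hQle : ∀ Q : Set (Space × Space), γ Q ≤ γ (Bdᶜ ∩ Q) + γ Bd := by
    intro Q
    refine (measure_mono fun p hp => ?_).trans (measure_union_le _ _)
    by_cases h : p ∈ Bd
    · exact Or.inr h
    · exact Or.inl ⟨h, hp⟩
  have hGle : ∀ Q : Set (Space × Space), γ Bd < γ Q / 2 → γ Bd ≤ γ (Bdᶜ ∩ Q) := by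
    intro Q hQ
    by_contra hlt
    rw [not_le] at hlt
    have h2 : γ Q < γ Q / 2 + γ Q / 2 :=
      (hQle Q).trans_lt (ENNReal.add_lt_add (hlt.trans hQ) hQ)
    rw [ENNReal.add_halves] at h2
    exact lt_irrefl _ h2
  have hGpos : ∀ Q : Set (Space × Space), γ Bd < γ Q / 2 → γ (Bdᶜ ∩ Q) ≠ 0 := by
    intro Q hQ h0
    have h1 : γ Bd = 0 := nonpos_iff_eq_zero.1 (h0 ▸ hGle Q hQ)
    have h2 := hQle Q
    rw [h0, h1, zero_add, nonpos_iff_eq_zero] at h2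
    simp [h2] at hQ
  have hQ₂' : (Bdᶜ \ Q₁) ∩ Q₂ = Bdᶜ ∩ Q₂ := by
    ext p
    have : p ∈ Q₂ → p ∉ Q₁ := fun hp hp' => Set.disjoint_left.1 hdisj hp' hp
    simp only [Set.mem_inter_iff, Set.mem_sdiff]
    tauto
  have hG₁u : G₁ Set.univ = γ (Bdᶜ ∩ Q₁) := by simp [hG₁]
  have hG₂u : G₂ Set.univ = γ (Bdᶜ ∩ Q₂) := by simp [hG₂, hQ₂']
  have hG₁0 : G₁ Set.univ ≠ 0 := hG₁u ▸ hGpos _ hn₁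
  have hG₂0 : G₂ Set.univ ≠ 0 := hG₂u ▸ hGpos _ hn₂
  -- The fraction of the reservoir consumed by the exchange. It must be at most 1 for the unused
  -- part (1 - t₁) G₁ to complete a decomposition of γ.
  set t₁ := Γ₁ Set.univ / G₁ Set.univ with ht₁
  set t₂ := Γ₂ Set.univ / G₂ Set.univ with ht₂
  have ht₁1 : t₁ ≤ 1 := by
    refine ENNReal.div_le_of_le_mul ?_
    rw [one_mul, hG₁u]
    exact (hΓle ▸ le_self_add : Γ₁ Set.univ ≤ γ Bd).trans (hGle _ hn₁)
  have ht₂1 : t₂ ≤ 1 := by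
    refine ENNReal.div_le_of_le_mul ?_
    rw [one_mul, hG₂u]
    exact (hΓle ▸ le_add_self : Γ₂ Set.univ ≤ γ Bd).trans (hGle _ hn₂)
  set N := P + (1 - t₁) • G₁ + (1 - t₂) • G₂ with hN
  have hsplit : γ = N + (Γ₁ + t₁ • G₁) + (Γ₂ + t₂ • G₂) := by
    have s₁ : G₁ = (1 - t₁) • G₁ + t₁ • G₁ := by
      rw [← add_smul, tsub_add_cancel_of_le ht₁1, one_smul]
    have s₂ : G₂ = (1 - t₂) • G₂ + t₂ • G₂ := by
      rw [← add_smul, tsub_add_cancel_of_le ht₂1, one_smul]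
    calc γ = P + G₁ + G₂ + Γ₁ + Γ₂ := hdec
      _ = P + ((1 - t₁) • G₁ + t₁ • G₁) + ((1 - t₂) • G₂ + t₂ • G₂) + Γ₁ + Γ₂ := by
        rw [← s₁, ← s₂]
      _ = _ := by rw [hN]; abel
  have hNγ : N ≤ γ := by
    conv_rhs => rw [hsplit, add_assoc]
    exact Measure.le_add_right le_rfl
  refine ⟨N + exchange Γ₁ G₁ + exchange Γ₂ G₂, ?_, ?_, ?_, ?_⟩
  · rw [Measure.map_add _ _ measurable_fst, Measure.map_add _ _ measurable_fst,
      map_fst_exchange hG₁0, map_fst_exchange hG₂0, ← Measure.map_add _ _ measurable_fst,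
      ← Measure.map_add _ _ measurable_fst, ← ht₁, ← ht₂, ← hsplit, h₁]
  · rw [Measure.map_add _ _ measurable_snd, Measure.map_add _ _ measurable_snd,
      map_snd_exchange hG₁0, map_snd_exchange hG₂0, ← Measure.map_add _ _ measurable_snd,
      ← Measure.map_add _ _ measurable_snd, ← ht₁, ← ht₂, ← hsplit, h₂]
  all_goals
    have hΓ₁a : ∀ᵐ p ∂Γ₁, p.1 ∈ U S₁ ∧ p.2 ∈ U S₁ :=
      ae_restrict_of_forall_mem (hBdm.inter (hTm.preimage measurable_fst)) hb₁
    have hΓ₂a : ∀ᵐ p ∂Γ₂, p.1 ∈ U S₂ ∧ p.2 ∈ U S₂ :=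
      ae_restrict_of_forall_mem (hBdm.diff (hTm.preimage measurable_fst)) hb₂
    have hG₁a : ∀ᵐ p ∂G₁, p.1 ∈ S₁ ∧ p.2 ∈ S₁ :=
      ae_restrict_of_forall_mem (hBdm.compl.inter hQ₁m) fun p hp => hp.2
    have hG₂a : ∀ᵐ p ∂G₂, p.1 ∈ S₂ ∧ p.2 ∈ S₂ :=
      ae_restrict_of_forall_mem ((hBdm.compl.diff hQ₁m).inter hQ₂m) fun p hp => hp.2
    have hex : ∀ S : Set Space, ∀ p : Space × Space, (∀ x ∈ S, ‖x‖ ≤ R) →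
        (p.1 ∈ U S ∧ p.2 ∈ S) ∨ (p.1 ∈ S ∧ p.2 ∈ U S) →
        r ≤ dist p.1 p.2 ∧ (‖p.1‖ ≤ R ∨ ‖p.2‖ ≤ R) := by
      intro S p hSR hp
      simp only [hU, Set.mem_iInter, Set.mem_ofPred_eq] at hp
      rcases hp with ⟨h, h'⟩ | ⟨h, h'⟩
      · exact ⟨h _ h', Or.inr (hSR _ h')⟩
      · exact ⟨dist_comm p.1 p.2 ▸ h' _ h, Or.inl (hSR _ h)⟩
    have hE₁ := (ae_exchange hS₁.measurableSet (hUm _) hΓ₁a hG₁a).mono fun p => hex _ p hR₁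
    have hE₂ := (ae_exchange hS₂.measurableSet (hUm _) hΓ₂a hG₂a).mono fun p => hex _ p hR₂
  · have hgood : ∀ p ∈ Bdᶜ, 1 / ((n : ℝ) + 1) ≤ dist p.1 p.2 ∧
        (‖p.1‖ ≤ max R n ∨ ‖p.2‖ ≤ max R n) := by
      intro p hp
      simp only [hBd, badPairs, Set.mem_compl_iff, Set.mem_union, Set.mem_ofPred_eq, not_or,
        not_and_or, not_lt] at hp
      exact ⟨hp.1, hp.2.imp (fun h => h.trans (le_max_right _ _))
        (fun h => h.trans (le_max_right _ _))⟩
    refine ⟨1 / ((n : ℝ) + 1), by positivity, max R n, ?_⟩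
    have hw : ∀ p : Space × Space, r ≤ dist p.1 p.2 ∧ (‖p.1‖ ≤ R ∨ ‖p.2‖ ≤ R) →
        1 / ((n : ℝ) + 1) ≤ dist p.1 p.2 ∧ (‖p.1‖ ≤ max R n ∨ ‖p.2‖ ≤ max R n) := fun p hp =>
      ⟨hn₄.le.trans hp.1, hp.2.imp (fun h => h.trans (le_max_left _ _))
        (fun h => h.trans (le_max_left _ _))⟩
    refine ae_add_measure_iff.2 ⟨ae_add_measure_iff.2 ⟨?_, hE₁.mono hw⟩, hE₂.mono hw⟩
    refine ae_add_measure_iff.2 ⟨ae_add_measure_iff.2 ⟨?_, ?_⟩, ?_⟩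
    · exact ae_restrict_of_forall_mem ((hBdm.compl.diff hQ₁m).diff hQ₂m)
        fun p hp => hgood p hp.1.1
    · exact Measure.ae_smul_measure (ae_restrict_of_forall_mem (hBdm.compl.inter hQ₁m)
        fun p hp => hgood p hp.1) _
    · exact Measure.ae_smul_measure (ae_restrict_of_forall_mem ((hBdm.compl.diff hQ₁m).inter hQ₂m)
        fun p hp => hgood p hp.1.1) _
  · rw [lintegral_add_measure, lintegral_add_measure, add_assoc]
    refine add_le_add (lintegral_mono' hNγ le_rfl) ?_
    have hc : ∀ ν : Measure (Space × Space),
        (∀ᵐ p ∂ν, r ≤ dist p.1 p.2 ∧ (‖p.1‖ ≤ R ∨ ‖p.2‖ ≤ R)) →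
        ∫⁻ p, coulomb p ∂ν ≤ (ENNReal.ofReal r)⁻¹ * ν Set.univ := by
      intro ν hν
      rw [← lintegral_const]
      exact lintegral_mono_ae (hν.mono fun p hp => coulomb_le_of_le_dist hp.1)
    refine (add_le_add (hc _ hE₁) (hc _ hE₂)).trans ?_
    rw [exchange_univ hG₁0, exchange_univ hG₂0, ← mul_add, ← mul_add, hΓle]
    calc (ENNReal.ofReal r)⁻¹ * (2 * γ Bd)
        ≤ (ENNReal.ofReal r)⁻¹ * (2 * (ε * ENNReal.ofReal r / 2)) := by gcongr
      _ = ε := by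
        rw [ENNReal.mul_div_cancel two_ne_zero ENNReal.ofNat_ne_top, mul_left_comm,
          ENNReal.inv_mul_cancel hr' ENNReal.ofReal_ne_top, mul_one]

/-! ### Smooth partitions into squares -/

/-- A finite family of smooth functions with `∑ ηᵢ² = 1`, each supported in a set of small diameter
or outside a large ball. -/
lemma exists_smooth_sq_partition {h : ℝ} (hh : 0 < h) (R : ℝ) :
    ∃ (ι : Type) (_ : Fintype ι) (η : ι → Space → ℝ), (∀ i, ContDiff ℝ ∞ (η i)) ∧
      (∀ i, ∃ C, ∀ x, ‖fderiv ℝ (η i) x‖ ≤ C) ∧ (∀ x, ∑ i, η i x ^ 2 = 1) ∧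
      ∀ i, (∀ x y, η i x ≠ 0 → η i y ≠ 0 → dist x y ≤ h) ∨ (∀ x, η i x ≠ 0 → R < ‖x‖) := by
  set R' : ℝ := max R 1 with hR'
  have hR'0 : 0 < R' := lt_of_lt_of_le one_pos (le_max_right _ _)
  obtain ⟨t, ht, htf, htc⟩ := finite_cover_balls_of_compact
    (isCompact_closedBall (0 : Space) (R' + 1)) (show 0 < h / 4 by positivity)
  have : Fintype t := htf.fintype
  let bmp : ∀ z : t, ContDiffBump (z : Space) := fun z => ⟨h / 4, h / 2, by positivity, by linarith⟩
  let bmp₀ : ContDiffBump (0 : Space) := ⟨R', R' + 1, hR'0, by linarith⟩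
  -- The index `none` is the cell at infinity. It equals 1 outside the ball of radius R' + 1, and
  -- inside that ball some small bump equals 1, so ∑ θᵢ² never vanishes and may be normalized.
  let θ : Option t → Space → ℝ := fun i => i.elim (fun x => 1 - bmp₀ x) (fun z x => bmp z x)
  have hθs : ∀ i, ContDiff ℝ ∞ (θ i) := by
    rintro (_ | z)
    · exact contDiff_const.sub bmp₀.contDiff
    · exact (bmp z).contDiff
  set σ : Space → ℝ := fun x => ∑ i, θ i x ^ 2 with hσ
  have hσs : ContDiff ℝ ∞ σ := ContDiff.sum fun i _ => (hθs i).pow 2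
  have hσ1 : ∀ x i, θ i x ^ 2 ≤ σ x := fun x i =>
    Finset.single_le_sum (f := fun i => θ i x ^ 2) (fun _ _ => sq_nonneg _) (Finset.mem_univ i)
  have hσ0 : ∀ x, 0 < σ x := by
    intro x
    by_cases hx : x ∈ Metric.closedBall (0 : Space) (R' + 1)
    · obtain ⟨z, hz, hxz⟩ := Set.mem_iUnion₂.1 (htc hx)
      have h1 : θ (some ⟨z, hz⟩) x = 1 :=
        (bmp ⟨z, hz⟩).one_of_mem_closedBall (Metric.ball_subset_closedBall hxz)
      have := hσ1 x (some ⟨z, hz⟩)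
      rw [h1] at this
      linarith
    · have h0 : bmp₀ x = 0 := by
        refine bmp₀.zero_of_le_dist ?_
        rw [Metric.mem_closedBall, not_le] at hx
        exact hx.le
      have h1 : θ none x = 1 := by simp [θ, h0]
      have := hσ1 x none
      rw [h1] at this
      linarith
  have hsq : ∀ x, 0 < Real.sqrt (σ x) := fun x => Real.sqrt_pos.2 (hσ0 x)
  set η : Option t → Space → ℝ := fun i x => θ i x / Real.sqrt (σ x) with hη
  have hηs : ∀ i, ContDiff ℝ ∞ (η i) := fun i =>
    (hθs i).div (hσs.sqrt fun x => (hσ0 x).ne') fun x => (hsq x).ne'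
  have hη0 : ∀ i x, η i x ≠ 0 → θ i x ≠ 0 := by
    intro i x hx h0
    exact hx (by simp [hη, h0])
  have hbmp : ∀ z : t, ∀ x, θ (some z) x ≠ 0 → dist x z < h / 2 := by
    intro z x hx
    by_contra hlt
    exact hx ((bmp z).zero_of_le_dist (not_lt.1 hlt))
  have hbdd : ∀ f : Space → ℝ, ContDiff ℝ ∞ f → HasCompactSupport f →
      ∃ C, ∀ x, ‖fderiv ℝ f x‖ ≤ C := fun f hf hc =>
    (hc.fderiv (𝕜 := ℝ)).exists_bound_of_continuous (hf.continuous_fderiv (by simp))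
  refine ⟨Option t, inferInstance, η, hηs, ?_, ?_, ?_⟩
  · rintro (_ | z)
    -- The outer function is not compactly supported, but it is identically 1 far out. Subtracting 1
    -- gives compact support without changing the gradient.
    · obtain ⟨C, hC⟩ := hbdd (fun x => η none x - 1) ((hηs none).sub contDiff_const) (by
        refine HasCompactSupport.intro (isCompact_closedBall (0 : Space) (R' + 1 + h)) ?_
        intro x hx
        rw [Metric.mem_closedBall, not_le, dist_zero_right] at hx
        have h0 : bmp₀ x = 0 := by
          refine bmp₀.zero_of_le_dist ?_
          rw [dist_zero_right]
          change R' + 1 ≤ ‖x‖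
          linarith
        have h1 : θ none x = 1 := by simp [θ, h0]
        have h2 : ∀ z : t, θ (some z) x = 0 := by
          intro z
          by_contra hne
          have h3 := hbmp z x hne
          have h4 := ht z.2
          rw [Metric.mem_closedBall, dist_zero_right] at h4
          have h5 := norm_sub_norm_le x (z : Space)
          rw [← dist_eq_norm] at h5
          linarith
        have h3 : σ x = 1 := by simp [hσ, Fintype.sum_option, h1, h2]
        simp [hη, h1, h3])
      refine ⟨C, fun x => ?_⟩
      have := hC x
      rwa [fderiv_sub_const] at this
    · refine hbdd _ (hηs _) (HasCompactSupport.intro (isCompact_closedBall (z : Space) (h / 2)) ?_)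
      intro x hx
      by_contra hne
      exact hx (Metric.mem_closedBall.2 (hbmp z x (hη0 _ _ hne)).le)
  · intro x
    simp only [hη, div_pow, ← Finset.sum_div, Real.sq_sqrt (hσ0 x).le]
    exact div_self (hσ0 x).ne'
  · rintro (_ | z)
    · right
      intro x hx
      by_contra hlt
      refine hη0 _ _ hx ?_
      have : bmp₀ x = 1 := by
        refine bmp₀.one_of_mem_closedBall ?_
        rw [Metric.mem_closedBall, dist_zero_right]
        exact (not_lt.1 hlt).trans (le_max_left _ _)
      simp [θ, this]
    · left
      intro x y hx hy
      have h1 := hbmp z x (hη0 _ _ hx)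
      have h2 := hbmp z y (hη0 _ _ hy)
      linarith [dist_triangle_right x y (z : Space)]

/-! ### Block densities -/

section Block

variable {ι : Type*} [Fintype ι] {X : Type*} [MeasurableSpace X] {μ : Measure X}

/-- The block density `∑ᵢⱼ Wᵢⱼ / (wᵢ wⱼ) χᵢ(x) χⱼ(y)`, relative to `μ ⊗ μ`, of a plan with
block masses `Wᵢⱼ`. -/
def blockDensity (μ : Measure X) (χ : ι → X → ℝ≥0∞) (W : ι → ι → ℝ≥0∞) (x y : X) : ℝ≥0∞ :=
  ∑ i, ∑ j, W i j / ((∫⁻ z, χ i z ∂μ) * ∫⁻ z, χ j z ∂μ) * (χ i x * χ j y)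

/-- Integrating out y turns χⱼ(y) into wⱼ = ∫ χⱼ dμ, which cancels one denominator. The row sums
cancel the other and leave ∑ χᵢ(x) = 1. Where wⱼ = 0 no cancellation is possible, and `hW0` makes
the term vanish instead. -/
lemma ae_lintegral_blockDensity [IsFiniteMeasure μ] {χ : ι → X → ℝ≥0∞}
    (hχ : ∀ i, Measurable (χ i)) (hsum : ∀ x, ∑ i, χ i x = 1) {W : ι → ι → ℝ≥0∞}
    (hW : ∀ i, ∑ j, W i j = ∫⁻ x, χ i x ∂μ)
    (hW0 : ∀ i j, ∫⁻ x, χ j x ∂μ = 0 → W i j = 0) :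
    ∀ᵐ x ∂μ, ∫⁻ y, blockDensity μ χ W x y ∂μ = 1 := by
  have hfin : ∀ i, ∫⁻ x, χ i x ∂μ ≠ ⊤ := by
    intro i
    have : ∫⁻ x, χ i x ∂μ ≤ ∫⁻ _, 1 ∂μ := lintegral_mono fun x => by
      rw [← hsum x]
      exact Finset.single_le_sum (f := fun i => χ i x) (fun _ _ => zero_le) (Finset.mem_univ i)
    refine ne_top_of_le_ne_top ?_ this
    simp
  have hz : ∀ᵐ x ∂μ, ∀ i, ∫⁻ x, χ i x ∂μ = 0 → χ i x = 0 := by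
    rw [ae_all_iff]
    intro i
    by_cases h : ∫⁻ x, χ i x ∂μ = 0
    · exact ((lintegral_eq_zero_iff (hχ i)).1 h).mono fun x hx _ => hx
    · exact Eventually.of_forall fun x h' => absurd h' h
  filter_upwards [hz] with x hx
  have hint : ∫⁻ y, blockDensity μ χ W x y ∂μ =
      ∑ i, ∑ j, W i j / ((∫⁻ z, χ i z ∂μ) * ∫⁻ z, χ j z ∂μ) * (χ i x * ∫⁻ z, χ j z ∂μ) := by
    unfold blockDensity
    rw [lintegral_finsetSum _ fun i _ => by fun_prop]
    refine Finset.sum_congr rfl fun i _ => ?_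
    rw [lintegral_finsetSum _ fun j _ => by fun_prop]
    refine Finset.sum_congr rfl fun j _ => ?_
    rw [lintegral_const_mul _ (by fun_prop), lintegral_const_mul _ (hχ j)]
  rw [hint, ← hsum x]
  refine Finset.sum_congr rfl fun i _ => ?_
  by_cases hi : ∫⁻ z, χ i z ∂μ = 0
  · simp [hx i hi]
  have hij : ∀ j, W i j / ((∫⁻ z, χ i z ∂μ) * ∫⁻ z, χ j z ∂μ) * (χ i x * ∫⁻ z, χ j z ∂μ)
      = W i j * ((∫⁻ z, χ i z ∂μ)⁻¹ * χ i x) := by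
    intro j
    by_cases hj : ∫⁻ z, χ j z ∂μ = 0
    · simp [hW0 i j hj]
    · rw [div_eq_mul_inv, ENNReal.mul_inv (Or.inl hi) (Or.inl (hfin i))]
      calc _ = W i j * ((∫⁻ z, χ i z ∂μ)⁻¹ * χ i x) *
            ((∫⁻ z, χ j z ∂μ)⁻¹ * ∫⁻ z, χ j z ∂μ) := by ring
        _ = _ := by rw [ENNReal.inv_mul_cancel hj (hfin j), mul_one]
  simp only [hij]
  rw [← Finset.sum_mul, hW, ← mul_assoc, ENNReal.mul_inv_cancel hi (hfin i), one_mul]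

/-- If the cost varies by at most `ε` on each charged block, replacing a plan by its block
density increases the cost by at most `ε`. -/
lemma lintegral_blockDensity_le [IsProbabilityMeasure μ] {χ : ι → X → ℝ≥0∞}
    (hχ : ∀ i, Measurable (χ i)) (hsum : ∀ x, ∑ i, χ i x = 1) {γ : Measure (X × X)}
    [IsProbabilityMeasure γ] {c : X × X → ℝ≥0∞} (hc : Measurable c) {ε : ℝ≥0∞}
    (hcε : ∀ i j, ∫⁻ p, χ i p.1 * χ j p.2 ∂γ ≠ 0 → ∀ x x' y y', χ i x ≠ 0 → χ i x' ≠ 0 →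
      χ j y ≠ 0 → χ j y' ≠ 0 → c (x, y) ≤ c (x', y') + ε) :
    ∫⁻ p, c p * blockDensity μ χ (fun i j => ∫⁻ p, χ i p.1 * χ j p.2 ∂γ) p.1 p.2 ∂(μ.prod μ)
      ≤ ∫⁻ p, c p ∂γ + ε := by
  set W : ι → ι → ℝ≥0∞ := fun i j => ∫⁻ p, χ i p.1 * χ j p.2 ∂γ with hWdef
  set w : ι → ℝ≥0∞ := fun i => ∫⁻ z, χ i z ∂μ with hw
  have hm₁ : ∀ i, Measurable fun p : X × X => χ i p.1 := fun i => (hχ i).comp measurable_fst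
  have hm₂ : ∀ i, Measurable fun p : X × X => χ i p.2 := fun i => (hχ i).comp measurable_snd
  have hL : ∫⁻ p, c p * blockDensity μ χ W p.1 p.2 ∂(μ.prod μ)
      = ∑ i, ∑ j, ∫⁻ p, c p * (W i j / (w i * w j) * (χ i p.1 * χ j p.2)) ∂(μ.prod μ) := by
    simp only [blockDensity, Finset.mul_sum]
    rw [lintegral_finsetSum _ fun i _ => by fun_prop]
    refine Finset.sum_congr rfl fun i _ => ?_
    rw [lintegral_finsetSum _ fun j _ => by fun_prop]
  have hR : ∫⁻ p, c p ∂γ + ε = ∑ i, ∑ j, ∫⁻ p, (c p + ε) * (χ i p.1 * χ j p.2) ∂γ := by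
    have : ∫⁻ p, c p ∂γ + ε = ∫⁻ p, ∑ i, ∑ j, (c p + ε) * (χ i p.1 * χ j p.2) ∂γ := by
      simp only [← Finset.mul_sum, hsum, mul_one]
      rw [lintegral_add_left hc]
      simp
    rw [this, lintegral_finsetSum _ fun i _ => by fun_prop]
    refine Finset.sum_congr rfl fun i _ => ?_
    rw [lintegral_finsetSum _ fun j _ => by fun_prop]
  rw [hL, hR]
  refine Finset.sum_le_sum fun i _ => Finset.sum_le_sum fun j _ => ?_
  by_cases hij : W i j = 0
  · simp [hij]
  -- Both sides are compared with M · Wᵢⱼ, where M is the supremum of the cost on the cell. The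
  -- block density puts mass at most Wᵢⱼ there, and c + ε ≥ M throughout the cell.
  set A : Set (X × X) := {p | χ i p.1 ≠ 0 ∧ χ j p.2 ≠ 0} with hA
  set M : ℝ≥0∞ := ⨆ p ∈ A, c p with hM
  have hL' : ∫⁻ p, c p * (W i j / (w i * w j) * (χ i p.1 * χ j p.2)) ∂(μ.prod μ) ≤ M * W i j := by
    calc _ ≤ ∫⁻ p, M * (W i j / (w i * w j)) * (χ i p.1 * χ j p.2) ∂(μ.prod μ) := by
          refine lintegral_mono fun p => ?_
          by_cases hp : p ∈ A
          · rw [mul_assoc]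
            gcongr
            exact le_iSup₂ (f := fun p (_ : p ∈ A) => c p) p hp
          · have : χ i p.1 * χ j p.2 = 0 := by
              by_contra hne
              exact hp (mul_ne_zero_iff.1 hne)
            simp [this]
      _ = M * (W i j / (w i * w j) * (w i * w j)) := by
          rw [lintegral_const_mul _ (by fun_prop),
            lintegral_prod_mul (hχ i).aemeasurable (hχ j).aemeasurable, mul_assoc]
      _ ≤ M * W i j := by gcongr; rw [mul_comm]; exact ENNReal.mul_div_le
  refine hL'.trans ?_
  rw [hWdef, ← lintegral_const_mul _ (by fun_prop)]
  refine lintegral_mono fun p => ?_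
  by_cases hp : p ∈ A
  · gcongr
    exact iSup₂_le fun q hq => hcε i j hij _ _ _ _ hq.1 hp.1 hq.2 hp.2
  · have : χ i p.1 * χ j p.2 = 0 := by
      by_contra hne
      exact hp (mul_ne_zero_iff.1 hne)
    simp [this]

end Block

/-! ### Smoothing a separated plan -/

lemma coulomb_eq_ofReal {p : Space × Space} (h : 0 < dist p.1 p.2) :
    coulomb p = ENNReal.ofReal (dist p.1 p.2)⁻¹ := by
  rw [coulomb, ← ofReal_norm, ← dist_eq_norm, ENNReal.ofReal_inv_of_pos h]

/-- The Coulomb cost is uniformly continuous away from the diagonal. -/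
lemma coulomb_le_coulomb_add {δ h ε : ℝ} (hδ : 0 < δ) (hε : 0 ≤ ε) (hh : 8 * h ≤ ε * δ ^ 2)
    {p q : Space × Space} (hp : δ / 2 ≤ dist p.1 p.2) (hq : δ / 2 ≤ dist q.1 q.2)
    (h₁ : dist p.1 q.1 ≤ h) (h₂ : dist p.2 q.2 ≤ h) :
    coulomb p ≤ coulomb q + ENNReal.ofReal ε := by
  have hp0 : 0 < dist p.1 p.2 := by linarith
  have hq0 : 0 < dist q.1 q.2 := by linarith
  rw [coulomb_eq_ofReal hp0, coulomb_eq_ofReal hq0,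
    ← ENNReal.ofReal_add (inv_nonneg.2 hq0.le) hε]
  refine ENNReal.ofReal_le_ofReal ?_
  have htri : dist q.1 q.2 ≤ dist p.1 p.2 + 2 * h := by
    have := dist_triangle4 q.1 p.1 p.2 q.2
    rw [dist_comm q.1 p.1] at this
    linarith
  set a := dist p.1 p.2
  set b := dist q.1 q.2
  have hab : δ ^ 2 / 4 ≤ a * b := by nlinarith
  have h3 : b - a ≤ ε * (a * b) := by nlinarith
  have h4 : a⁻¹ - b⁻¹ = (b - a) / (a * b) := by field_simp
  have h5 : (b - a) / (a * b) ≤ ε := (div_le_iff₀ (mul_pos hp0 hq0)).2 h3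
  linarith

/-- A plan at positive distance from the diagonal and with one particle in a bounded set can be
replaced, at arbitrarily small cost, by one whose density with respect to `μ ⊗ μ` is a finite sum
of squares of smooth functions. -/
lemma exists_smooth_plan {μ : Measure Space} [IsProbabilityMeasure μ]
    {γ : Measure (Space × Space)} (h₁ : γ.map Prod.fst = μ) (h₂ : γ.map Prod.snd = μ)
    {δ R : ℝ} (hδ : 0 < δ)
    (hγ : ∀ᵐ p ∂γ, δ ≤ dist p.1 p.2 ∧ (‖p.1‖ ≤ R ∨ ‖p.2‖ ≤ R)) {ε : ℝ} (hε : 0 < ε) :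
    ∃ (κ : Type) (_ : Fintype κ) (b : κ → Space × Space → ℝ), (∀ k, ContDiff ℝ ∞ (b k)) ∧
      (∀ k, ∃ C, ∀ p, |b k p| ≤ C) ∧ (∀ k, ∃ C, ∀ p, ‖fderiv ℝ (b k) p‖ ≤ C) ∧
      (∀ᵐ x ∂μ, ∫⁻ y, ENNReal.ofReal (∑ k, b k (x, y) ^ 2) ∂μ = 1) ∧
      (∀ᵐ y ∂μ, ∫⁻ x, ENNReal.ofReal (∑ k, b k (x, y) ^ 2) ∂μ = 1) ∧
      ∫⁻ p, coulomb p * ENNReal.ofReal (∑ k, b k p ^ 2) ∂(μ.prod μ)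
        ≤ ∫⁻ p, coulomb p ∂γ + ENNReal.ofReal ε := by
  have hγu : γ Set.univ = 1 := by
    have := congrArg (fun ν : Measure Space => ν Set.univ) h₁
    simpa [Measure.map_apply measurable_fst .univ] using this
  have : IsProbabilityMeasure γ := ⟨hγu⟩
  -- The bound δ/4 keeps pairs in a charged cell at distance at least δ/2. The other bound comes
  -- from |1/a - 1/b| ≤ 2h / (δ/2)² = 8h/δ² for a, b ≥ δ/2 with |a - b| ≤ 2h.
  set h : ℝ := min (δ / 4) (ε * δ ^ 2 / 8) with hhdef
  have hh : 0 < h := lt_min (by positivity) (by positivity)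
  have hh₁ : h ≤ δ / 4 := min_le_left _ _
  have hh₂ : 8 * h ≤ ε * δ ^ 2 := by linarith [min_le_right (δ / 4) (ε * δ ^ 2 / 8)]
  -- A small cell meeting the ball of radius R lies in the ball of radius R + h, so it is at
  -- distance at least 1/ε from the outer cell.
  obtain ⟨ι, _, η, hηs, hηd, hη1, hηc⟩ := exists_smooth_sq_partition hh (R + h + ε⁻¹)
  have hε' : 0 < ε⁻¹ := inv_pos.2 hε
  set χ : ι → Space → ℝ≥0∞ := fun i x => ENNReal.ofReal (η i x ^ 2) with hχdef
  have hχ : ∀ i, Measurable (χ i) := fun i => by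
    have := (hηs i).continuous
    fun_prop
  have hχη : ∀ i x, χ i x ≠ 0 → η i x ≠ 0 := by
    intro i x hx h0
    exact hx (by simp [hχdef, h0])
  have hsum : ∀ x, ∑ i, χ i x = 1 := by
    intro x
    rw [hχdef, ← ENNReal.ofReal_sum_of_nonneg fun _ _ => sq_nonneg _, hη1, ENNReal.ofReal_one]
  have hm₁ : ∀ i, Measurable fun p : Space × Space => χ i p.1 := fun i =>
    (hχ i).comp measurable_fst
  have hm₂ : ∀ i, Measurable fun p : Space × Space => χ i p.2 := fun i =>
    (hχ i).comp measurable_snd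
  have hm : ∀ i j, Measurable fun p : Space × Space => χ i p.1 * χ j p.2 := fun i j =>
    (hm₁ i).mul (hm₂ j)
  set W : ι → ι → ℝ≥0∞ := fun i j => ∫⁻ p, χ i p.1 * χ j p.2 ∂γ with hW
  have hrow : ∀ i, ∑ j, W i j = ∫⁻ x, χ i x ∂μ := by
    intro i
    rw [hW, ← lintegral_finsetSum _ fun j _ => hm i j]
    simp only [← Finset.mul_sum, hsum, mul_one]
    rw [← h₁, lintegral_map (hχ i) measurable_fst]
  have hcol : ∀ j, ∑ i, W i j = ∫⁻ x, χ j x ∂μ := by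
    intro j
    rw [hW, ← lintegral_finsetSum _ fun i _ => hm i j]
    simp only [← Finset.sum_mul, hsum, one_mul]
    rw [← h₂, lintegral_map (hχ j) measurable_snd]
  have hrow0 : ∀ i j, ∫⁻ x, χ j x ∂μ = 0 → W i j = 0 := by
    intro i j hj
    rw [← hcol, Finset.sum_eq_zero_iff] at hj
    exact hj i (Finset.mem_univ i)
  have hcol0 : ∀ i j, ∫⁻ x, χ j x ∂μ = 0 → W j i = 0 := by
    intro i j hj
    rw [← hrow, Finset.sum_eq_zero_iff] at hj
    exact hj i (Finset.mem_univ i)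
  -- the cost varies little on every charged cell
  have hcell : ∀ i j, W i j ≠ 0 → ∀ x x' y y', χ i x ≠ 0 → χ i x' ≠ 0 →
      χ j y ≠ 0 → χ j y' ≠ 0 → coulomb (x, y) ≤ coulomb (x', y') + ENNReal.ofReal ε := by
    intro i j hij x x' y y' hx hx' hy hy'
    have hex : ∃ p : Space × Space, (δ ≤ dist p.1 p.2 ∧ (‖p.1‖ ≤ R ∨ ‖p.2‖ ≤ R)) ∧
        η i p.1 ≠ 0 ∧ η j p.2 ≠ 0 := by
      by_contra hne
      push Not at hne
      refine hij ((lintegral_eq_zero_iff (hm i j)).2 (hγ.mono fun p hp => ?_))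
      by_contra hnz
      have hnz' := mul_ne_zero_iff.1 hnz
      exact hχη _ _ hnz'.2 (hne p hp (hχη _ _ hnz'.1))
    obtain ⟨⟨x₀, y₀⟩, ⟨hd, hb⟩, hx₀, hy₀⟩ := hex
    have hext : ∀ u v : Space, R + h + ε⁻¹ < ‖u‖ → ‖v‖ ≤ R + h → ε⁻¹ ≤ dist u v := by
      intro u v hu hv
      have := norm_sub_norm_le u v
      rw [dist_eq_norm]
      linarith
    have hinv : (ENNReal.ofReal ε⁻¹)⁻¹ = ENNReal.ofReal ε := by
      rw [← ENNReal.ofReal_inv_of_pos hε', inv_inv]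
    have hnear : ∀ u v : Space, ‖u‖ ≤ R → dist v u ≤ h → ‖v‖ ≤ R + h := by
      intro u v hu hv
      have := norm_sub_norm_le v u
      rw [dist_eq_norm] at hv
      linarith
    -- For two small cells the cost is uniformly continuous. With exactly one outer cell the cost is
    -- at most ε outright. Two outer cells cannot be charged, since one particle of the plan stays
    -- within R.
    rcases hηc i with hi | hi <;> rcases hηc j with hj | hj
    · have hx1 := hi x x₀ (hχη _ _ hx) hx₀
      have hx2 := hi x' x₀ (hχη _ _ hx') hx₀
      have hy1 := hj y y₀ (hχη _ _ hy) hy₀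
      have hy2 := hj y' y₀ (hχη _ _ hy') hy₀
      have hfar : ∀ u v, dist u x₀ ≤ h → dist v y₀ ≤ h → δ / 2 ≤ dist u v := by
        intro u v hu hv
        have := dist_triangle4 x₀ u v y₀
        rw [dist_comm x₀ u] at this
        simp only at hd
        linarith
      exact coulomb_le_coulomb_add hδ hε.le hh₂ (hfar _ _ hx1 hy1) (hfar _ _ hx2 hy2)
        (hi x x' (hχη _ _ hx) (hχη _ _ hx')) (hj y y' (hχη _ _ hy) (hχη _ _ hy'))
    · have hy₀R := hj y₀ hy₀
      have hx₀R : ‖x₀‖ ≤ R := hb.resolve_right (by simp only; linarith)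
      have := hext y x (hj y (hχη _ _ hy)) (hnear x₀ x hx₀R (hi x x₀ (hχη _ _ hx) hx₀))
      refine le_trans ?_ le_add_self
      rw [← hinv]
      exact coulomb_le_of_le_dist (by rw [dist_comm]; exact this)
    · have hx₀R := hi x₀ hx₀
      have hy₀R : ‖y₀‖ ≤ R := hb.resolve_left (by simp only; linarith)
      have := hext x y (hi x (hχη _ _ hx)) (hnear y₀ y hy₀R (hj y y₀ (hχη _ _ hy) hy₀))
      refine le_trans ?_ le_add_self
      rw [← hinv]
      exact coulomb_le_of_le_dist this
    · have hx₀R := hi x₀ hx₀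
      have hy₀R := hj y₀ hy₀
      simp only at hb
      rcases hb with hb | hb <;> linarith
  have hWle : ∀ i j, W i j ≠ ⊤ := by
    intro i j
    refine ne_top_of_le_ne_top (b := (1 : ℝ≥0∞)) ENNReal.one_ne_top ?_
    calc W i j ≤ ∑ k, W i k :=
          Finset.single_le_sum (f := fun k => W i k) (fun _ _ => zero_le) (Finset.mem_univ j)
      _ = ∫⁻ x, χ i x ∂μ := hrow i
      _ ≤ ∫⁻ _, 1 ∂μ := lintegral_mono fun x => by
          rw [← hsum x]
          exact Finset.single_le_sum (f := fun i => χ i x) (fun _ _ => zero_le) (Finset.mem_univ i)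
      _ = 1 := by simp
  set co : ι → ι → ℝ≥0∞ := fun i j => W i j / ((∫⁻ z, χ i z ∂μ) * ∫⁻ z, χ j z ∂μ) with hco
  have hcofin : ∀ i j, co i j ≠ ⊤ := by
    intro i j htop
    -- A vanishing denominator means a cell of zero μ-mass, which by the marginal conditions forces
    -- Wᵢⱼ = 0, and 0 / 0 = 0 in `ℝ≥0∞`.
    rcases ENNReal.div_eq_top.1 htop with ⟨hne, h0⟩ | ⟨ht, -⟩
    · rcases mul_eq_zero.1 h0 with h0 | h0
      · exact hne (hcol0 j i h0)
      · exact hne (hrow0 i j h0)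
    · exact hWle i j ht
  set b : ι × ι → Space × Space → ℝ := fun k p =>
    Real.sqrt (co k.1 k.2).toReal * (η k.1 p.1 * η k.2 p.2) with hb
  have hbK : ∀ p : Space × Space,
      ENNReal.ofReal (∑ k, b k p ^ 2) = blockDensity μ χ W p.1 p.2 := by
    intro p
    rw [ENNReal.ofReal_sum_of_nonneg fun _ _ => sq_nonneg _, Fintype.sum_prod_type, blockDensity]
    refine Finset.sum_congr rfl fun i _ => Finset.sum_congr rfl fun j _ => ?_
    rw [hb]
    simp only [mul_pow, Real.sq_sqrt ENNReal.toReal_nonneg]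
    rw [ENNReal.ofReal_mul ENNReal.toReal_nonneg, ENNReal.ofReal_toReal (hcofin i j),
      ENNReal.ofReal_mul (sq_nonneg _)]
  have hηle : ∀ i x, |η i x| ≤ 1 := by
    intro i x
    rw [← sq_le_one_iff_abs_le_one, ← hη1 x]
    exact Finset.single_le_sum (f := fun i => η i x ^ 2) (fun _ _ => sq_nonneg _)
      (Finset.mem_univ i)
  have hηf : ∀ i, ContDiff ℝ ∞ fun p : Space × Space => η i p.1 := fun i =>
    (hηs i).comp contDiff_fst
  have hηn : ∀ i, ContDiff ℝ ∞ fun p : Space × Space => η i p.2 := fun i =>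
    (hηs i).comp contDiff_snd
  refine ⟨ι × ι, inferInstance, b, fun k => ?_, fun k => ?_, fun k => ?_, ?_, ?_, ?_⟩
  · exact contDiff_const.mul ((hηf k.1).mul (hηn k.2))
  · refine ⟨Real.sqrt (co k.1 k.2).toReal, fun p => ?_⟩
    rw [hb]
    simp only [abs_mul, abs_of_nonneg (Real.sqrt_nonneg _)]
    refine mul_le_of_le_one_right (Real.sqrt_nonneg _) ?_
    exact mul_le_one₀ (hηle _ _) (abs_nonneg _) (hηle _ _)
  · obtain ⟨C₁, hC₁⟩ := hηd k.1
    obtain ⟨C₂, hC₂⟩ := hηd k.2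
    refine ⟨Real.sqrt (co k.1 k.2).toReal * (C₂ + C₁), fun p => ?_⟩
    have d₁ : HasFDerivAt (fun p : Space × Space => η k.1 p.1)
        ((fderiv ℝ (η k.1) p.1).comp (ContinuousLinearMap.fst ℝ Space Space)) p :=
      (((hηs k.1).differentiable (by simp) p.1).hasFDerivAt).comp p hasFDerivAt_fst
    have d₂ : HasFDerivAt (fun p : Space × Space => η k.2 p.2)
        ((fderiv ℝ (η k.2) p.2).comp (ContinuousLinearMap.snd ℝ Space Space)) p :=
      (((hηs k.2).differentiable (by simp) p.2).hasFDerivAt).comp p hasFDerivAt_snd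
    have n₁ : ‖(fderiv ℝ (η k.1) p.1).comp (ContinuousLinearMap.fst ℝ Space Space)‖ ≤ C₁ := by
      refine (ContinuousLinearMap.opNorm_comp_le _ _).trans ?_
      exact (mul_le_of_le_one_right (norm_nonneg _)
        (ContinuousLinearMap.norm_fst_le ℝ Space Space)).trans (hC₁ _)
    have n₂ : ‖(fderiv ℝ (η k.2) p.2).comp (ContinuousLinearMap.snd ℝ Space Space)‖ ≤ C₂ := by
      refine (ContinuousLinearMap.opNorm_comp_le _ _).trans ?_
      exact (mul_le_of_le_one_right (norm_nonneg _)
        (ContinuousLinearMap.norm_snd_le ℝ Space Space)).trans (hC₂ _)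
    have d := (d₁.mul d₂).const_mul (Real.sqrt (co k.1 k.2).toReal)
    have hfd : fderiv ℝ (b k) p = _ := d.fderiv
    rw [hfd, norm_smul, Real.norm_eq_abs, abs_of_nonneg (Real.sqrt_nonneg _)]
    refine mul_le_mul_of_nonneg_left ?_ (Real.sqrt_nonneg _)
    refine (norm_add_le _ _).trans (add_le_add ?_ ?_)
    · rw [norm_smul]
      exact (mul_le_of_le_one_left (norm_nonneg _) (hηle _ _)).trans n₂
    · rw [norm_smul]
      exact (mul_le_of_le_one_left (norm_nonneg _) (hηle _ _)).trans n₁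
  · simp only [hbK]
    exact ae_lintegral_blockDensity hχ hsum hrow hrow0
  -- Transposing the block masses exchanges the variables, so the second marginal follows from the
  -- first with column sums in place of row sums.
  · have hT : ∀ x y, blockDensity μ χ W x y = blockDensity μ χ (fun i j => W j i) y x := by
      intro x y
      unfold blockDensity
      rw [Finset.sum_comm]
      refine Finset.sum_congr rfl fun i _ => Finset.sum_congr rfl fun j _ => ?_
      rw [mul_comm (χ j x), mul_comm (∫⁻ z, χ j z ∂μ)]
    simp only [hbK, hT]
    exact ae_lintegral_blockDensity hχ hsum hcol hcol0
  · simp only [hbK]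
    exact lintegral_blockDensity_le hχ hsum measurable_coulomb hcell

/-! ### The interaction energy of a wave function is at least the transport cost -/

lemma pairDensity_nonneg (Ψ : Space × Spin → Space × Spin → ℂ) (p : Space × Space) :
    0 ≤ pairDensity Ψ p :=
  Finset.sum_nonneg fun _ _ => Finset.sum_nonneg fun _ _ => sq_nonneg _

lemma IsWaveFunction.pairDensity_swap {Ψ : Space × Spin → Space × Spin → ℂ}
    (hΨ : IsWaveFunction Ψ) : ∀ᵐ p : Space × Space, pairDensity Ψ p.swap = pairDensity Ψ p := by
  have h : ∀ᵐ p : Space × Space, ∀ s t : Spin, Ψ (p.2, t) (p.1, s) = - Ψ (p.1, s) (p.2, t) := by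
    rw [ae_all_iff]
    intro s
    rw [ae_all_iff]
    exact hΨ.antisymm s
  filter_upwards [h] with p hp
  unfold pairDensity
  rw [Finset.sum_comm]
  refine Finset.sum_congr rfl fun s _ => Finset.sum_congr rfl fun t _ => ?_
  simp only [spatial, Prod.fst_swap, Prod.snd_swap, hp s t, norm_neg]

lemma IsWaveFunction.integrable_pairDensity {Ψ : Space × Spin → Space × Spin → ℂ}
    (hΨ : IsWaveFunction Ψ) : Integrable (pairDensity Ψ) := by
  -- The Bochner integral of a non-integrable function is 0, so normalization to 1 already forces
  -- integrability.
  by_contra h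
  have := hΨ.norm_eq_one
  rw [integral_undef h] at this
  exact zero_ne_one this

/-- The pair density of a wave function is a transport plan. -/
lemma IsWaveFunction.hasMarginals {Ψ : Space × Spin → Space × Spin → ℂ} {ρ : Space → ℝ}
    (hΨ : IsWaveFunction Ψ) (hρ : density Ψ =ᵐ[volume] ρ) :
    HasMarginals (volume.withDensity fun p => ENNReal.ofReal (pairDensity Ψ p)) ρ := by
  have hint := hΨ.integrable_pairDensity
  have hm : AEMeasurable (fun p => ENNReal.ofReal (pairDensity Ψ p)) volume :=
    hint.1.aemeasurable.ennreal_ofReal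
  have hsec : ∀ᵐ x : Space, 2 * ∫⁻ y : Space, ENNReal.ofReal (pairDensity Ψ (x, y))
      = ENNReal.ofReal (ρ x) := by
    have hi : ∀ᵐ x : Space, Integrable fun y : Space => pairDensity Ψ (x, y) :=
      hint.prod_right_ae
    filter_upwards [hi, hρ] with x hx hxρ
    rw [← hxρ, density, ENNReal.ofReal_mul zero_le_two, ENNReal.ofReal_ofNat,
      ofReal_integral_eq_lintegral_ofReal hx (Eventually.of_forall fun y => pairDensity_nonneg _ _)]
  have hfst : (2 : ℝ≥0∞) • (volume.withDensity fun p : Space × Space =>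
      ENNReal.ofReal (pairDensity Ψ p)).map Prod.fst
      = volume.withDensity (fun x => ENNReal.ofReal (ρ x)) := by
    ext A hA
    rw [Measure.smul_apply, Measure.map_apply measurable_fst hA,
      withDensity_apply _ (measurable_fst hA), withDensity_apply _ hA,
      ← lintegral_indicator (measurable_fst hA), ← lintegral_indicator hA, smul_eq_mul,
      Measure.volume_eq_prod, lintegral_prod _ ((hm.indicator (measurable_fst hA))),
      ← lintegral_const_mul' _ _ ENNReal.ofNat_ne_top]
    refine lintegral_congr_ae ?_
    filter_upwards [hsec] with x hx
    by_cases hxA : x ∈ A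
    · simpa [Set.indicator, hxA] using hx
    · simp [Set.indicator, hxA]
  refine ⟨hfst, ?_⟩
  -- Antisymmetry makes the pair density symmetric almost everywhere, hence the two marginals agree.
  have hsw : (volume.withDensity fun p : Space × Space =>
      ENNReal.ofReal (pairDensity Ψ p)).map Prod.swap
      = volume.withDensity fun p : Space × Space => ENNReal.ofReal (pairDensity Ψ p) := by
    ext A hA
    rw [Measure.map_apply measurable_swap hA, withDensity_apply _ (measurable_swap hA),
      withDensity_apply _ hA, ← lintegral_indicator (measurable_swap hA),
      ← lintegral_indicator hA, Measure.volume_eq_prod, ← lintegral_prod_swap]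
    refine lintegral_congr_ae ?_
    filter_upwards [hΨ.pairDensity_swap] with p hp
    have hmem : p.swap ∈ Prod.swap ⁻¹' A ↔ p ∈ A := by simp
    by_cases h : p ∈ A
    · rw [Set.indicator_of_mem (hmem.2 h), Set.indicator_of_mem h, hp]
    · rw [Set.indicator_of_notMem (mt hmem.1 h), Set.indicator_of_notMem h]
  rw [← hsw, Measure.map_map measurable_snd measurable_swap, ← hfst]
  rfl

lemma IsWaveFunction.optimalTransport_le {Ψ : Space × Spin → Space × Spin → ℂ} {ρ : Space → ℝ}
    (hΨ : IsWaveFunction Ψ) (hρ : density Ψ =ᵐ[volume] ρ) :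
    optimalTransport ρ ≤ interactionEnergy Ψ := by
  refine iInf₂_le_of_le _ (hΨ.hasMarginals hρ) (le_of_eq ?_)
  rw [lintegral_withDensity_eq_lintegral_mul₀
    hΨ.integrable_pairDensity.1.aemeasurable.ennreal_ofReal measurable_coulomb.aemeasurable,
    interactionEnergy]
  simp only [Pi.mul_apply, mul_comm]

lemma optimalTransport_le_hohenbergKohn (m hbar : ℝ) (ρ : Space → ℝ) :
    optimalTransport ρ ≤ hohenbergKohn m hbar ρ :=
  le_iInf fun _ => le_iInf fun hΨ => le_iInf fun hρ =>
    (hΨ.optimalTransport_le hρ).trans le_add_self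

/-- Wave functions have finite kinetic energy. -/
lemma IsWaveFunction.lintegral_gradSq_ne_top {Ψ : Space × Spin → Space × Spin → ℂ}
    (hΨ : IsWaveFunction Ψ) :
    ∑ s : Spin, ∑ t : Spin, ∫⁻ p : Space × Space, gradSq (spatial Ψ s t) p ≠ ⊤ := by
  refine ENNReal.sum_ne_top.2 fun s _ => ENNReal.sum_ne_top.2 fun t _ => ?_
  have hL : ∀ v, MemLp (weakDeriv (spatial Ψ s t) v) 2 volume := by
    intro v
    have h := (hΨ.memH1 s t).2 v
    rw [weakDeriv, dif_pos h]
    exact h.choose_spec.1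
  have hfin : ∀ v, ∫⁻ p, ‖weakDeriv (spatial Ψ s t) v p‖ₑ ^ 2 ≠ ⊤ := by
    intro v
    have := lintegral_rpow_enorm_lt_top_of_eLpNorm_lt_top (p := 2) two_ne_zero
      ENNReal.ofNat_ne_top (hL v).2
    simpa using this.ne
  have hme : ∀ v, AEMeasurable (fun p => ‖weakDeriv (spatial Ψ s t) v p‖ₑ ^ 2) volume := fun v =>
    (hL v).1.enorm.pow_const 2
  have hme' : ∀ v v', AEMeasurable (fun p => ‖weakDeriv (spatial Ψ s t) v p‖ₑ ^ 2
      + ‖weakDeriv (spatial Ψ s t) v' p‖ₑ ^ 2) volume := fun v v' => (hme v).add (hme v')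
  unfold gradSq
  rw [lintegral_finsetSum' _ fun k _ => hme' _ _]
  refine ENNReal.sum_ne_top.2 fun k _ => ?_
  rw [lintegral_add_left' (hme _)]
  exact ENNReal.add_ne_top.2 ⟨hfin _, hfin _⟩

/-! ### Admissible densities and their plans -/

/-- The probability measure `ρ(x) dx / 2`. -/
def halfDensity (ρ : Space → ℝ) : Measure Space :=
  volume.withDensity fun x => ENNReal.ofReal (ρ x / 2)

instance (ρ : Space → ℝ) : NullSingletonClass (halfDensity ρ) := by
  unfold halfDensity
  infer_instance

lemma two_smul_halfDensity (ρ : Space → ℝ) :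
    (2 : ℝ≥0∞) • halfDensity ρ = volume.withDensity fun x => ENNReal.ofReal (ρ x) := by
  rw [halfDensity, ← withDensity_smul' _ _ ENNReal.ofNat_ne_top]
  congr 1
  ext x
  rw [Pi.smul_apply, smul_eq_mul, ← ENNReal.ofReal_ofNat 2, ← ENNReal.ofReal_mul zero_le_two]
  congr 1
  ring

lemma hasMarginals_iff {γ : Measure (Space × Space)} {ρ : Space → ℝ} :
    HasMarginals γ ρ ↔ γ.map Prod.fst = halfDensity ρ ∧ γ.map Prod.snd = halfDensity ρ := by
  have h : ∀ α β : Measure Space, (2 : ℝ≥0∞) • α = (2 : ℝ≥0∞) • β ↔ α = β := by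
    intro α β
    refine ⟨fun h => ?_, fun h => h ▸ rfl⟩
    have := congrArg (fun ν : Measure Space => (2 : ℝ≥0∞)⁻¹ • ν) h
    simpa only [smul_smul, ENNReal.inv_mul_cancel two_ne_zero ENNReal.ofNat_ne_top, one_smul]
      using this
  rw [HasMarginals, ← two_smul_halfDensity, h, h]

lemma IsAdmissible.isProbabilityMeasure {ρ : Space → ℝ} (hρ : IsAdmissible ρ) :
    IsProbabilityMeasure (halfDensity ρ) := by
  have hint : Integrable ρ := by
    by_contra h
    have := hρ.integral_eq
    rw [integral_undef h] at this
    norm_num at this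
  refine ⟨?_⟩
  rw [halfDensity, withDensity_apply _ .univ, setLIntegral_univ,
    ← ofReal_integral_eq_lintegral_ofReal (hint.div_const 2)
      (hρ.nonneg.mono fun x hx => div_nonneg hx zero_le_two), integral_div, hρ.integral_eq]
  norm_num

/-- Both `ENNReal.ofReal` and `Real.sqrt` send negative numbers to 0, so ρ can be exchanged for
(√ρ)² at every point without using its sign. -/
lemma ofReal_half_eq (r : ℝ) : ENNReal.ofReal (r / 2) = ENNReal.ofReal (Real.sqrt r ^ 2 / 2) := by
  rcases le_total 0 r with h | h
  · rw [Real.sq_sqrt h]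
  · rw [Real.sqrt_eq_zero_of_nonpos h, ENNReal.ofReal_of_nonpos (by linarith)]
    simp

lemma IsAdmissible.aemeasurable {ρ : Space → ℝ} (hρ : IsAdmissible ρ) :
    AEMeasurable (fun x => ENNReal.ofReal (ρ x / 2)) volume := by
  rw [funext fun x => ofReal_half_eq (ρ x)]
  exact ((hρ.sqrt_memH1.1.1.aemeasurable.pow_const 2).div_const 2).ennreal_ofReal

lemma measure_diagonal_eq_zero {γ : Measure (Space × Space)} (h : ∫⁻ p, coulomb p ∂γ ≠ ⊤) :
    γ (Set.diagonal Space) = 0 := by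
  have := ae_lt_top measurable_coulomb h
  refine measure_mono_null ?_ (ae_iff.1 this)
  intro p hp
  have hp' : p.1 = p.2 := hp
  simp [coulomb, hp']

/-- No estimate on the Coulomb energy of μ ⊗ μ is needed. This plan does not charge the diagonal, so
it can be modified into one at distance at least δ from it, with cost at most 1/δ. -/
lemma IsAdmissible.optimalTransport_lt_top {ρ : Space → ℝ} (hρ : IsAdmissible ρ) :
    optimalTransport ρ < ⊤ := by
  have := hρ.isProbabilityMeasure
  set μ := halfDensity ρ with hμ
  have hd : (μ.prod μ) (Set.diagonal Space) = 0 := by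
    rw [Measure.measure_prod_null measurableSet_diagonal]
    refine Eventually.of_forall fun x => ?_
    have : Prod.mk x ⁻¹' Set.diagonal Space = {x} := by
      ext y
      simp [eq_comm]
    simp [this]
  obtain ⟨γ, h₁, h₂, ⟨δ, hδ, R, hγ⟩, -⟩ := exists_separated_plan (μ := μ) (γ := μ.prod μ)
    (by simp) (by simp) hd one_ne_zero
  refine (iInf₂_le γ (hasMarginals_iff.2 ⟨h₁, h₂⟩)).trans_lt ?_
  have hγu : γ Set.univ = 1 := by
    have := congrArg (fun ν : Measure Space => ν Set.univ) h₁
    simpa [Measure.map_apply measurable_fst .univ] using this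
  refine (lintegral_mono_ae (hγ.mono fun p hp => coulomb_le_of_le_dist hp.1)).trans_lt ?_
  rw [lintegral_const, hγu, mul_one, ENNReal.inv_lt_top]
  simpa using hδ

/-! ### Wave functions with prescribed pair density -/

/-- The antisymmetric wave function built from an arbitrary spatial function `ψ`: particle one has
spin up and particle two spin down in the component `ψ`. -/
def antisymmetrize (ψ : Space × Space → ℝ) : Space × Spin → Space × Spin → ℂ := fun X Y =>
  if X.2 = 0 ∧ Y.2 = 1 then (ψ (X.1, Y.1) : ℂ)
  else if X.2 = 1 ∧ Y.2 = 0 then ((-ψ (Y.1, X.1) : ℝ) : ℂ) else 0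

lemma antisymmetrize_antisymm (ψ : Space × Space → ℝ) (x y : Space) (s t : Spin) :
    antisymmetrize ψ (y, t) (x, s) = - antisymmetrize ψ (x, s) (y, t) := by
  fin_cases s <;> fin_cases t <;> simp [antisymmetrize]

lemma pairDensity_antisymmetrize (ψ : Space × Space → ℝ) (p : Space × Space) :
    pairDensity (antisymmetrize ψ) p = ψ p ^ 2 + ψ p.swap ^ 2 := by
  simp [pairDensity, spatial, antisymmetrize, Fin.sum_univ_two, Prod.swap]

lemma memH1_spatial_antisymmetrize {ψ : Space × Space → ℝ} (h : MemH1 ψ)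
    (h' : MemH1 fun p : Space × Space => ψ p.swap) (s t : Spin) :
    MemH1 (spatial (antisymmetrize ψ) s t) := by
  have hn : MemH1 fun p : Space × Space => ((-ψ p.swap : ℝ) : ℂ) := by
    have := (h'.const_mul (-1)).ofReal
    simpa only [neg_one_mul] using this
  fin_cases s <;> fin_cases t
  · exact memH1_zero
  · exact h.ofReal
  · exact hn
  · exact memH1_zero

lemma coulomb_swap (p : Space × Space) : coulomb p.swap = coulomb p := by
  simp only [coulomb, Prod.fst_swap, Prod.snd_swap]
  rw [← enorm_neg, neg_sub]

section Realization

variable {ρ : Space → ℝ} {κ : Type} [Fintype κ]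

/-- The spatial wave function `√(K/8) √ρ(x) √ρ(y)` with `K = ∑ bₖ²`. -/
def spatialWave (ρ : Space → ℝ) (b : κ → Space × Space → ℝ) (p : Space × Space) : ℝ :=
  Real.sqrt (1 / 8) *
    (Real.sqrt (∑ k, b k p ^ 2) * (Real.sqrt (ρ p.1) * Real.sqrt (ρ p.2)))

/-- This accounts for the constant 1/8: a factor 1/4 turns ρ ⊗ ρ into μ ⊗ μ, and a factor 1/2
anticipates the two spin components that share the mass. -/
lemma ofReal_spatialWave_sq (b : κ → Space × Space → ℝ) (p : Space × Space) :
    ENNReal.ofReal (spatialWave ρ b p ^ 2) = 2⁻¹ * (ENNReal.ofReal (∑ k, b k p ^ 2) *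
      (ENNReal.ofReal (ρ p.1 / 2) * ENNReal.ofReal (ρ p.2 / 2))) := by
  have hK : 0 ≤ ∑ k, b k p ^ 2 := Finset.sum_nonneg fun _ _ => sq_nonneg _
  have h2 : (2⁻¹ : ℝ≥0∞) = ENNReal.ofReal (2⁻¹) := by
    rw [ENNReal.ofReal_inv_of_pos two_pos, ENNReal.ofReal_ofNat]
  rw [ofReal_half_eq (ρ p.1), ofReal_half_eq (ρ p.2), h2, ← ENNReal.ofReal_mul (by positivity),
    ← ENNReal.ofReal_mul hK, ← ENNReal.ofReal_mul (by positivity)]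
  congr 1
  rw [spatialWave, mul_pow, mul_pow, Real.sq_sqrt (by norm_num), Real.sq_sqrt hK]
  ring

lemma memH1_spatialWave (hρ : IsAdmissible ρ) {b : κ → Space × Space → ℝ}
    (hb : ∀ k, ContDiff ℝ ∞ (b k)) (hbd : ∀ k, ∃ C, ∀ p, |b k p| ≤ C)
    (hbd' : ∀ k, ∃ C, ∀ p, ‖fderiv ℝ (b k) p‖ ≤ C) : MemH1 (spatialWave ρ b) :=
  ((hρ.sqrt_memH1.tensor hρ.sqrt_memH1).sqrt_sum_sq_mul hb hbd hbd').const_mul _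

lemma spatialWave_swap (b : κ → Space × Space → ℝ) (p : Space × Space) :
    spatialWave ρ b p.swap = spatialWave ρ (fun k q => b k q.swap) p := by
  simp only [spatialWave, Prod.fst_swap, Prod.snd_swap, mul_comm (Real.sqrt (ρ p.2))]

lemma memH1_spatialWave_swap (hρ : IsAdmissible ρ) {b : κ → Space × Space → ℝ}
    (hb : ∀ k, ContDiff ℝ ∞ (b k)) (hbd : ∀ k, ∃ C, ∀ p, |b k p| ≤ C)
    (hbd' : ∀ k, ∃ C, ∀ p, ‖fderiv ℝ (b k) p‖ ≤ C) :
    MemH1 fun p : Space × Space => spatialWave ρ b p.swap := by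
  simp only [spatialWave_swap]
  set sw : Space × Space →L[ℝ] Space × Space :=
    (ContinuousLinearMap.snd ℝ Space Space).prod (ContinuousLinearMap.fst ℝ Space Space) with hsw
  refine memH1_spatialWave hρ (fun k => (hb k).comp sw.contDiff) (fun k => ?_) fun k => ?_
  · obtain ⟨C, hC⟩ := hbd k
    exact ⟨C, fun p => hC _⟩
  · obtain ⟨C, hC⟩ := hbd' k
    refine ⟨C * ‖sw‖, fun p => ?_⟩
    have hd : HasFDerivAt (fun q : Space × Space => b k q.swap)
        ((fderiv ℝ (b k) p.swap).comp sw) p :=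
      HasFDerivAt.comp (f := sw) p (((hb k).differentiable (by simp) p.swap).hasFDerivAt)
        sw.hasFDerivAt
    rw [hd.fderiv]
    exact (ContinuousLinearMap.opNorm_comp_le _ _).trans
      (mul_le_mul_of_nonneg_right (hC _) (norm_nonneg _))

/-- A coupling of `ρ/2` with itself whose density with respect to the product coupling is a sum of
squares of smooth functions comes from a wave function. -/
lemma exists_waveFunction (hρ : IsAdmissible ρ) {b : κ → Space × Space → ℝ}
    (hb : ∀ k, ContDiff ℝ ∞ (b k)) (hbd : ∀ k, ∃ C, ∀ p, |b k p| ≤ C)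
    (hbd' : ∀ k, ∃ C, ∀ p, ‖fderiv ℝ (b k) p‖ ≤ C)
    (hm₁ : ∀ᵐ x ∂(halfDensity ρ),
      ∫⁻ y, ENNReal.ofReal (∑ k, b k (x, y) ^ 2) ∂(halfDensity ρ) = 1)
    (hm₂ : ∀ᵐ y ∂(halfDensity ρ),
      ∫⁻ x, ENNReal.ofReal (∑ k, b k (x, y) ^ 2) ∂(halfDensity ρ) = 1) :
    ∃ Ψ, IsWaveFunction Ψ ∧ density Ψ =ᵐ[volume] ρ ∧ interactionEnergy Ψ =
      ∫⁻ p, coulomb p * ENNReal.ofReal (∑ k, b k p ^ 2)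
        ∂((halfDensity ρ).prod (halfDensity ρ)) := by
  set ψ := spatialWave ρ b with hψ
  set d : Space → ℝ≥0∞ := fun x => ENNReal.ofReal (ρ x / 2) with hd
  set K : Space × Space → ℝ≥0∞ := fun p => ENNReal.ofReal (∑ k, b k p ^ 2) with hK
  have hdm : AEMeasurable d volume := hρ.aemeasurable
  have hKm : Measurable K := by
    have := fun k => (hb k).continuous
    fun_prop
  have hH := memH1_spatialWave hρ hb hbd hbd'
  have hH' := memH1_spatialWave_swap hρ hb hbd hbd'
  have hψ2 : ∀ p, ENNReal.ofReal (ψ p ^ 2) = 2⁻¹ * (K p * (d p.1 * d p.2)) :=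
    ofReal_spatialWave_sq b
  have hmψ : AEMeasurable (fun p => ENNReal.ofReal (ψ p ^ 2)) volume :=
    (hH.1.1.aemeasurable.pow_const 2).ennreal_ofReal
  set Ψ := antisymmetrize ψ with hΨ
  have hpd : ∀ p, ENNReal.ofReal (pairDensity Ψ p)
      = ENNReal.ofReal (ψ p ^ 2) + ENNReal.ofReal (ψ p.swap ^ 2) := fun p => by
    rw [hΨ, pairDensity_antisymmetrize, ENNReal.ofReal_add (sq_nonneg _) (sq_nonneg _)]
  have hpdm : AEStronglyMeasurable (pairDensity Ψ) volume := by
    have : pairDensity Ψ = fun p => ψ p ^ 2 + ψ p.swap ^ 2 :=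
      funext (pairDensity_antisymmetrize ψ)
    rw [this]
    exact (hH.1.1.pow 2).add (hH'.1.1.pow 2)
  -- the marginals
  have hsec : ∀ᵐ x : Space, ∫⁻ y : Space, ENNReal.ofReal (pairDensity Ψ (x, y)) = d x := by
    have hm₁' := (ae_withDensity_iff' hdm).1 hm₁
    have hm₂' := (ae_withDensity_iff' hdm).1 hm₂
    filter_upwards [hm₁', hm₂'] with x hx₁ hx₂
    have k₁ : Measurable fun y => K (x, y) := by fun_prop
    have k₂ : Measurable fun y => K (y, x) := by fun_prop
    have e₁ : ∫⁻ y : Space, ENNReal.ofReal (ψ (x, y) ^ 2)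
        = 2⁻¹ * d x * ∫⁻ y, K (x, y) ∂(halfDensity ρ) := by
      rw [halfDensity, lintegral_withDensity_eq_lintegral_mul₀ hdm k₁.aemeasurable,
        ← lintegral_const_mul'' _ (hdm.mul k₁.aemeasurable)]
      refine lintegral_congr fun y => ?_
      rw [hψ2]
      simp only [Pi.mul_apply, hd]
      ring
    have e₂ : ∫⁻ y : Space, ENNReal.ofReal (ψ (y, x) ^ 2)
        = 2⁻¹ * d x * ∫⁻ y, K (y, x) ∂(halfDensity ρ) := by
      rw [halfDensity, lintegral_withDensity_eq_lintegral_mul₀ hdm k₂.aemeasurable,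
        ← lintegral_const_mul'' _ (hdm.mul k₂.aemeasurable)]
      refine lintegral_congr fun y => ?_
      rw [hψ2]
      simp only [Pi.mul_apply, hd]
      ring
    have hadd : ∫⁻ y : Space, ENNReal.ofReal (pairDensity Ψ (x, y))
        = (∫⁻ y : Space, ENNReal.ofReal (ψ (x, y) ^ 2))
          + ∫⁻ y : Space, ENNReal.ofReal (ψ (y, x) ^ 2) := by
      simp only [hpd, Prod.swap_prod_mk]
      refine lintegral_add_left' ?_ _
      simp only [hψ2]
      exact (k₁.aemeasurable.mul (hdm.const_mul _)).const_mul _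
    rw [hadd, e₁, e₂]
    -- The marginal identities hold only μ-almost everywhere and say nothing where d x = 0, but
    -- there both terms carry the factor d x.
    by_cases hx : d x = 0
    · simp [hx]
    · rw [hx₁ hx, hx₂ hx, mul_one, ← add_mul, ENNReal.inv_two_add_inv_two, one_mul]
  have hprob := hρ.isProbabilityMeasure
  have hnorm : ∫⁻ p : Space × Space, ENNReal.ofReal (pairDensity Ψ p) = 1 := by
    rw [Measure.volume_eq_prod, lintegral_prod _ hpdm.aemeasurable.ennreal_ofReal,
      lintegral_congr_ae hsec]
    have := hprob.measure_univ
    rwa [halfDensity, withDensity_apply _ .univ, setLIntegral_univ] at this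
  have hmeas_sec : ∀ᵐ x : Space, AEStronglyMeasurable (fun y : Space => pairDensity Ψ (x, y)) :=
    AEStronglyMeasurable.prodMk_left hpdm
  refine ⟨Ψ, ⟨memH1_spatial_antisymmetrize hH hH', fun s t => Eventually.of_forall fun p =>
    antisymmetrize_antisymm ψ p.1 p.2 s t, ?_⟩, ?_, ?_⟩
  · rw [integral_eq_lintegral_of_nonneg_ae
      (Eventually.of_forall fun p => pairDensity_nonneg Ψ p) hpdm, hnorm, ENNReal.toReal_one]
  · filter_upwards [hsec, hmeas_sec, hρ.nonneg] with x hx hxm hx0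
    rw [density, integral_eq_lintegral_of_nonneg_ae
      (Eventually.of_forall fun y => pairDensity_nonneg Ψ _) hxm, hx, hd,
      ENNReal.toReal_ofReal (by positivity)]
    ring
  · have hcm : AEMeasurable (fun p : Space × Space => coulomb p * ENNReal.ofReal (ψ p ^ 2))
        volume := measurable_coulomb.aemeasurable.mul hmψ
    have hcK : AEMeasurable (fun p : Space × Space => coulomb p * K p)
        ((volume.prod volume).withDensity fun p : Space × Space => d p.1 * d p.2) :=
      (measurable_coulomb.mul hKm).aemeasurable
    -- The Coulomb cost is symmetric, so averaging the plan with its swap leaves the cost unchanged.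
    have hswap : ∫⁻ p : Space × Space, coulomb p * ENNReal.ofReal (ψ p.swap ^ 2)
        = ∫⁻ p : Space × Space, coulomb p * ENNReal.ofReal (ψ p ^ 2) := by
      rw [Measure.volume_eq_prod, ← lintegral_prod_swap]
      simp only [coulomb_swap, Prod.swap_swap]
    have hdd : AEMeasurable (fun p : Space × Space => d p.1 * d p.2) (volume.prod volume) :=
      hdm.comp_fst.mul hdm.comp_snd
    rw [interactionEnergy]
    simp only [hpd, mul_add]
    rw [lintegral_add_left' hcm, hswap, ← two_mul,
      ← lintegral_const_mul' _ _ ENNReal.ofNat_ne_top, halfDensity, prod_withDensity₀ hdm hdm,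
      lintegral_withDensity_eq_lintegral_mul₀' hdd hcK, Measure.volume_eq_prod]
    refine lintegral_congr fun p => ?_
    simp only [Pi.mul_apply]
    rw [hψ2]
    calc _ = (2 * 2⁻¹) * (d p.1 * d p.2 * (coulomb p * K p)) := by ring
      _ = _ := by rw [ENNReal.mul_inv_cancel two_ne_zero ENNReal.ofNat_ne_top, one_mul]

end Realization

/-! ### The upper bound and the semiclassical limit -/

/-- The transport cost is approached by interaction energies of wave functions of density `ρ`. -/
lemma IsAdmissible.exists_interactionEnergy_lt {ρ : Space → ℝ} (hρ : IsAdmissible ρ) {B : ℝ≥0∞}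
    (hB : optimalTransport ρ < B) :
    ∃ Ψ, IsWaveFunction Ψ ∧ density Ψ =ᵐ[volume] ρ ∧ interactionEnergy Ψ < B := by
  have := hρ.isProbabilityMeasure
  obtain ⟨γ, hγ⟩ := iInf_lt_iff.1 hB
  obtain ⟨hγρ, hγB⟩ := iInf_lt_iff.1 hγ
  obtain ⟨h₁, h₂⟩ := hasMarginals_iff.1 hγρ
  obtain ⟨ε, hε, hεB⟩ := ENNReal.lt_iff_exists_add_pos_lt.1 hγB
  -- Half of the gap below B pays for the separation of the plan, the other half for its smoothing.
  have hε2 : 0 < ε / 2 := half_pos hε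
  obtain ⟨γ', h₁', h₂', ⟨δ, hδ, R, hγ'⟩, hcost⟩ := exists_separated_plan h₁ h₂
    (measure_diagonal_eq_zero hγB.ne_top) (ENNReal.coe_ne_zero.2 hε2.ne')
  obtain ⟨κ, _, b, hb, hbd, hbd', hm₁, hm₂, hc⟩ :=
    exists_smooth_plan h₁' h₂' hδ hγ' (ε := ((ε / 2 : NNReal) : ℝ)) (by exact_mod_cast hε2)
  obtain ⟨Ψ, hΨ, hΨρ, hV⟩ := exists_waveFunction hρ hb hbd hbd' hm₁ hm₂
  refine ⟨Ψ, hΨ, hΨρ, ?_⟩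
  rw [hV]
  refine (hc.trans (add_le_add_left hcost _)).trans_lt ?_
  rw [ENNReal.ofReal_coe_nnreal, add_assoc, ← ENNReal.coe_add, add_halves]
  exact hεB

end SemiclassicalDFT

end

theorem theorem5p2 (m : ℝ) (hm : 0 < m) (ρ : SemiclassicalDFT.Space → ℝ)
    (hρ : SemiclassicalDFT.IsAdmissible ρ) :
    SemiclassicalDFT.optimalTransport ρ < ⊤ ∧
      Tendsto (fun hbar : ℝ => SemiclassicalDFT.hohenbergKohn m hbar ρ) (𝓝[>] 0)
        (𝓝 (SemiclassicalDFT.optimalTransport ρ)) := by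
  refine ⟨hρ.optimalTransport_lt_top, tendsto_order.2 ⟨fun B hB => ?_, fun B hB => ?_⟩⟩
  · exact Eventually.of_forall fun hbar =>
      hB.trans_le (SemiclassicalDFT.optimalTransport_le_hohenbergKohn m hbar ρ)
  -- Ψ is chosen before ħ. Its gradient integral may be enormous, but it is finite and independent
  -- of ħ, so the factor ħ²/(2m) sends the kinetic energy to 0.
  · obtain ⟨Ψ, hΨ, hΨρ, hV⟩ := hρ.exists_interactionEnergy_lt hB
    have hcoef : Tendsto (fun hbar : ℝ => ENNReal.ofReal (hbar ^ 2 / (2 * m))) (𝓝[>] 0) (𝓝 0) := by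
      have hc : Continuous fun hbar : ℝ => ENNReal.ofReal (hbar ^ 2 / (2 * m)) :=
        ENNReal.continuous_ofReal.comp (by fun_prop)
      have := (hc.tendsto 0).mono_left (nhdsWithin_le_nhds (s := Set.Ioi 0))
      simpa using this
    have hT : Tendsto (fun hbar : ℝ => SemiclassicalDFT.kineticEnergy m hbar Ψ) (𝓝[>] 0)
        (𝓝 0) := by
      have := ENNReal.Tendsto.mul_const hcoef (Or.inr hΨ.lintegral_gradSq_ne_top)
      simpa only [zero_mul, SemiclassicalDFT.kineticEnergy] using this
    have hsum := hT.add_const (SemiclassicalDFT.interactionEnergy Ψ)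
    rw [zero_add] at hsum
    filter_upwards [(tendsto_order.1 hsum).2 B hV] with hbar hlt
    exact (iInf_le_of_le Ψ (iInf₂_le hΨ hΨρ)).trans_lt hlt
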